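/- Let $K$ be a field complete for a normalized discrete valuation $val$, $R$ its ring of integers, $\pi$ a uniformizer, $A=K[X_1,\dots,X_n]$ and $w$ a monomial order on $A$. Let $LM(I)$ be the set of leading monomials of the non-zero elements of an ideal $I$. **Hypotheses.** $f_1,\dots,f_s\in A$ are homogeneous of degrees $d_1,\dots,d_s$ and such that (H1) $(f_1,\dots,f_s)$ is a regular sequence; (H2) for each $1\le i\le s$, the ideal $I_i=\langle f_1,\dots,f_i\rangle$ is weakly-$w$: if $x^\alpha$ is the leading monomial of an element of the reduced Gröbner basis of $I_i$, $|\beta|=|\alpha|$ and $x^\beta>_w x^\alpha$, then $x^\beta\in LM(I_i)$. **Approximate bases.** Let $O(\pi^e)=\pi^eR$ and $O(\pi^\infty)=0$. An approximate homogeneous polynomial $g+\sum_{|u|=|g|}O(\pi^{m_u})X^u$ stands for all the $g+\sum_u b_uX^u$ with $b_u\in O(\pi^{m_u})$, its specializations. A $D$-Gröbner basis of an ideal $I$ is a finite family in $I$ such that the leading monomial of every non-zero homogeneous element of $I$ of degree at most $D$ is divisible by the leading monomial of a non-zero member. An approximate $D$-Gröbner basis of approximate polynomials $F_1,\dots,F_s$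 is a finite sequence $G$ of approximate homogeneous polynomials with precisions $m_u\in\mathbb Z_{\ge0}\cup\{\infty\}$ such that each specialization of $F$ generates an ideal that has a $D$-Gröbner basis which is a specialization of $G$, and such that the leading monomial of each $g\in G$ is unambiguous: all its specializations are non-zero with the same leading monomial, and its coefficients at the greater monomials of degree $|g|$ are exact zeros. **Weak Matrix-F5.** For $d=0,\dots,D$ and $i=1,\dots,s$ let $\mathscr M_{d,i}$ consist of the rows of $\mathscr M_{d,i-1}$ ($\mathscr M_{d,0}$ is empty) and of the rows $x^\alpha f_i$ with $|\alpha|+d_i=d$ and $x^\alpha$ not the leading monomial of a row of $\widetilde{\mathscr M}_{d-d_i,i-1}$; columns are the monomials of degree $d$, decreasing for $w$. Reduce $\mathscr M_{d,i}$ by Gaussian elimination, taking in each column a pivot of smallest valuation among the entries certified to be non-zero and writing exact zeros for eliminated entries, up to the first column without such a pivot. Replace the remaining rows by multiples $X_kP$ of rows $P$ of $\widetilde{\mathscr M}_{d-1,i}$ so as to get a matrix $\widetilde{\mathscr M}_{d,i}$ in row-echelon form (up to permutation); return an error if this is not possible. Add to the output $G$ the rows of $\widetilde{\mathscr M}_{d,i}$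 whose leading monomial is new. Arithmetic is that of approximate numbers $x+O(\pi^e)$, kept at precision at most $m$ (exact zeros excepted). **Precision.** Let $\overline{Mac}_d(f_1,\dots,f_i)$ be the matrix whose rows are the $x^\alpha f_j$ with $j\le i$, $|\alpha|+d_j=d$ and $x^\alpha\notin LM(I_{j-1})$ (where $I_0=0$), with the same columns; let $l_{d,i}$ be the largest $l$ such that its first $l$ columns are linearly independent, and $\Delta_{d,i}$ the minimum of the valuations of its $l_{d,i}\times l_{d,i}$ minors on the first $l_{d,i}$ columns. Put $prec_{MF5}=\max_{d\le D,\,1\le i\le s}\Delta_{d,i}$ ($0$ if $s=0$). **Theorem 1.1.** There is an absolute constant $C$ such that, for all data as above and all $D\ge0$, the following holds. Let $f_i'$ be homogeneous of degree $d_i$ with $f_i'\equiv f_i$ modulo $\pi^m$ on the coefficients. 1. If $m$ is large enough (depending on $f$, $w$, $D$ but not on $f'$), then the $f'_i+\sum_{|u|=d_i}O(\pi^m)X^u$ have an approximate $D$-Gröbner basis for $w$, and the weak Matrix-F5 algorithm at precision $m$ computes one without error. 2. If moreover $f_1,\dots,f_s\in R[X_1,\dots,X_n]$, then every $m>prec_{MF5}$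 is large enough, and all coefficients of the computed basis are known at precision at least $m-prec_{MF5}$. 3. In both cases, if $D\ge1$, the algorithm uses at most $C\,sD\binom{n+D-1}{D}^3$ operations on numbers at precision $m$ (subtractions, multiplications, divisions, tests to zero and comparisons of valuations); for $f_i\in R[X_1,\dots,X_n]$ these are operations in $R$. -/

import Mathlib

noncomputable section

namespace WeakMF5

/-! ## Complete discrete valuation fields -/

/-- `v` is a normalized discrete valuation on `K` (with value group `ℤ` and `v 0 = ⊤`),
and `K` is complete for the topology defined by `v`. -/
structure IsCDVF {K : Type*} [Field K] (v : AddValuation K (WithTop ℤ)) : Prop where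
  surjective : Function.Surjective v
  complete : @CompleteSpace K (Valued.mk' (AddValuation.toValuation v)).toUniformSpace

/-! ## Finite-precision numbers -/

/-- `O(π ^ e)`, i.e. the elements of valuation at least `e`; `O(π ^ ⊤) = 0`. -/
def ball {K : Type*} [Field K] (v : AddValuation K (WithTop ℤ)) (e : WithTop ℤ) :
    AddSubgroup K where
  carrier := {x | e ≤ v x}
  zero_mem' := by simp
  add_mem' := fun {a b} ha hb => le_trans (le_min ha hb) (v.map_add a b)
  neg_mem' := fun {a} ha => by simpa using ha

/-- A number known at finite (absolute) precision: an order `e` and a coset `x + O(π ^ e)`.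
Order `⊤` means that the number is known exactly. -/
structure Approx {K : Type*} [Field K] (v : AddValuation K (WithTop ℤ)) where
  ord : WithTop ℤ
  cls : K ⧸ ball v ord

namespace Approx

variable {K : Type*} [Field K] {v : AddValuation K (WithTop ℤ)}

/-- The approximate number `x + O(π ^ e)`. -/
def of (v : AddValuation K (WithTop ℤ)) (e : WithTop ℤ) (x : K) : Approx v :=
  ⟨e, (x : K ⧸ ball v e)⟩

/-- The exact ("real") zero. -/
def exactZero (v : AddValuation K (WithTop ℤ)) : Approx v := of v ⊤ 0

/-- `x` is one of the numbers that `a` may stand for. -/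
def Contains (a : Approx v) (x : K) : Prop := (x : K ⧸ ball v a.ord) = a.cls

/-- The representative of the coset `a` in a fixed system of representatives
of `K` modulo `O(π ^ a.ord)` (it plays the role of the truncated `π`-adic expansion). -/
def center (a : Approx v) : K := Quotient.out a.cls

/-- `a` can be told apart from `0` (and then its valuation is that of its representative). -/
def NonzeroCertified (a : Approx v) : Prop := v a.center < a.ord

/-- `x + O(π ^ e)`, at working precision `m`: what is not exact is kept at order at most `m`. -/
def round (v : AddValuation K (WithTop ℤ)) (m : ℕ) (e : WithTop ℤ) (x : K) : Approx v :=
  of v (if e = ⊤ then ⊤ else min e ((m : ℤ) : WithTop ℤ)) x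

/-- `(x + O(π^e)) - (y + O(π^e')) = (x - y) + O(π^min(e,e'))`. -/
def sub (m : ℕ) (a b : Approx v) : Approx v :=
  round v m (min a.ord b.ord) (a.center - b.center)

/-- `(x + O(π^e)) (y + O(π^e')) = x y + O(π^min(val x + e', val y + e, e + e'))`. -/
def mul (m : ℕ) (a b : Approx v) : Approx v :=
  round v m (min (v a.center + b.ord) (min (v b.center + a.ord) (a.ord + b.ord)))
    (a.center * b.center)

/-- `(x + O(π^e)) / (y + O(π^e')) = x / y + O(π^min(e - val y, e' + val x - 2 val y))`,
meant for a divisor that is certified to be non-zero; `v y⁻¹ = - v y`. -/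
def div (m : ℕ) (a b : Approx v) : Approx v :=
  round v m (min (a.ord + v b.center⁻¹) (b.ord + v a.center + v b.center⁻¹ + v b.center⁻¹))
    (a.center / b.center)

end Approx

/-! ## Counting operations -/

/-- The result of a computation together with the number of operations on (finite-precision)
numbers that it used. -/
structure Counted (α : Type*) where
  val : α
  cost : ℕ

instance : Monad Counted where
  pure a := ⟨a, 0⟩
  bind x f := ⟨(f x.val).val, x.cost + (f x.val).cost⟩

/-- Perform an elementary computation that costs `k` operations. -/
def charge {α : Type*} (k : ℕ) (a : α) : Counted α := ⟨a, k⟩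

/-! ## Polynomials: Gröbner bases and weakly-`w`-ideals -/

/-- Exponents `u` of the monomials `X ^ u` in `n` variables. -/
abbrev Mon (n : ℕ) := Fin n →₀ ℕ

section Ideals

variable {K : Type*} [Field K] {n : ℕ}

/-- `LM(I)`: the (exponents of the) leading monomials of the non-zero elements of `I`. -/
def LM (w : MonomialOrder (Fin n)) (I : Ideal (MvPolynomial (Fin n) K)) : Set (Mon n) :=
  {α | ∃ p ∈ I, p ≠ 0 ∧ w.degree p = α}

/-- `G` is the reduced Gröbner basis of `I` (finiteness of `G` is automatic):
a Gröbner basis of `I`, made of monic polynomials, such that no monomial of an element of `G`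
is divisible by the leading monomial of another element of `G`. -/
structure IsReducedGB (w : MonomialOrder (Fin n)) (I : Ideal (MvPolynomial (Fin n) K))
    (G : Set (MvPolynomial (Fin n) K)) : Prop where
  subset : ∀ g ∈ G, g ∈ I
  exists_dvd : ∀ p ∈ I, p ≠ 0 → ∃ g ∈ G, w.degree g ≤ w.degree p
  monic : ∀ g ∈ G, w.leadingCoeff g = 1
  reduced : ∀ g ∈ G, ∀ g' ∈ G, g' ≠ g → ∀ u ∈ g.support, ¬ w.degree g' ≤ u

/-- `I` is a weakly-`w`-ideal: for every leading monomial `x ^ α` of the reduced Gröbner basis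
of `I`, every monomial `x ^ β` of the same degree with `x ^ β > x ^ α` lies in `LM(I)`. -/
def IsWeaklyIdeal (w : MonomialOrder (Fin n)) (I : Ideal (MvPolynomial (Fin n) K)) : Prop :=
  ∀ G, IsReducedGB w I G → ∀ g ∈ G, ∀ β : Mon n,
    β.degree = (w.degree g).degree → w.toSyn (w.degree g) < w.toSyn β → β ∈ LM w I

/-- The family `g` is a `D`-Gröbner basis of `I`. -/
def IsDGroebner (w : MonomialOrder (Fin n)) (D : ℕ) (I : Ideal (MvPolynomial (Fin n) K))
    {ι : Type*} (g : ι → MvPolynomial (Fin n) K) : Prop :=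
  (∀ j, g j ∈ I) ∧
    ∀ p ∈ I, p ≠ 0 → (∃ d ≤ D, p.IsHomogeneous d) → ∃ j, g j ≠ 0 ∧ w.degree (g j) ≤ w.degree p

end Ideals

/-! ## Approximate polynomials and approximate Gröbner bases -/

/-- An approximation of a homogeneous polynomial of degree `deg`; only the values of `coeff` at
exponents of degree `deg` matter. -/
structure APoly {K : Type*} [Field K] (v : AddValuation K (WithTop ℤ)) (n : ℕ) where
  deg : ℕ
  coeff : Mon n → Approx v

/-- The specializations `p` of the approximate polynomial `P`, i.e. the polynomials
`g + ∑ b_u X ^ u` with `b_u ∈ O(π ^ m_u)` when `P = g + ∑ O(π ^ m_u) X ^ u`. -/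
def APoly.Contains {K : Type*} [Field K] {v : AddValuation K (WithTop ℤ)} {n : ℕ}
    (P : APoly v n) (p : MvPolynomial (Fin n) K) : Prop :=
  p.IsHomogeneous P.deg ∧ ∀ u : Mon n, u.degree = P.deg → (P.coeff u).Contains (p.coeff u)

/-- `G` is an approximate `D`-Gröbner basis of the ideal generated by the approximate
polynomials `F`. -/
structure IsApproxDGroebner {K : Type*} [Field K] {v : AddValuation K (WithTop ℤ)} {n s : ℕ}
    (w : MonomialOrder (Fin n)) (D : ℕ) (F : Fin s → APoly v n) (G : List (APoly v n)) :
    Prop where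
  /-- the precisions on the coefficients are in `ℕ ∪ {∞}` -/
  ord_nonneg : ∀ P ∈ G, ∀ u : Mon n, u.degree = P.deg → 0 ≤ (P.coeff u).ord
  /-- every specialization of `F` has a `D`-Gröbner basis that is a specialization of `G` -/
  specialize : ∀ f : Fin s → MvPolynomial (Fin n) K, (∀ i, (F i).Contains (f i)) →
    ∃ g : Fin G.length → MvPolynomial (Fin n) K,
      (∀ j, (G.get j).Contains (g j)) ∧ IsDGroebner w D (Ideal.span (Set.range f)) g
  /-- the leading monomials are unambiguous -/
  leading : ∀ P ∈ G, ∃ α : Mon n, α.degree = P.deg ∧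
    (∀ u : Mon n, u.degree = P.deg → w.toSyn α < w.toSyn u →
      P.coeff u = Approx.exactZero v) ∧
    ∀ p, P.Contains p → p ≠ 0 ∧ w.degree p = α

/-- The approximation `p + ∑_{|u| = d} O(π ^ m) X ^ u`. -/
def approxPoly {K : Type*} [Field K] (v : AddValuation K (WithTop ℤ)) {n : ℕ} (m d : ℕ)
    (p : MvPolynomial (Fin n) K) : APoly v n :=
  ⟨d, fun u => Approx.of v ((m : ℤ) : WithTop ℤ) (p.coeff u)⟩

/-! ## Macaulay matrices with the F5 criterion, and the Matrix-F5 precision -/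

/-- The monomials of degree `d`, in decreasing order for `w`. -/
def monomials {n : ℕ} (w : MonomialOrder (Fin n)) (d : ℕ) : List (Mon n) :=
  (((Finset.finsuppAntidiag (Finset.univ : Finset (Fin n)) d).map
    w.toSyn.toEquiv.toEmbedding).sort (fun a b => b ≤ a)).map w.toSyn.symm

section Precision

variable {K : Type*} [Field K] {n s : ℕ}

/-- Indices `(j, α)` of the rows `x ^ α f_j` (`j ≤ i`, `|α| + d_j = d`) of the Macaulay matrix of
degree `d` of `f_1, …, f_i` that are kept by the F5 criterion: `x ^ α` is not a leading monomial of
`⟨f_1, …, f_{j-1}⟩`. -/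
def F5Row (w : MonomialOrder (Fin n)) (f : Fin s → MvPolynomial (Fin n) K) (deg : Fin s → ℕ)
    (d : ℕ) (i : Fin s) : Type :=
  {r : Fin s × Mon n // r.1 ≤ i ∧ r.2.degree + deg r.1 = d ∧
    r.2 ∉ LM w (Ideal.span (f '' Set.Iio r.1))}

/-- The matrix of the rows kept by the F5 criterion; column `j` is that of the `j`-th greatest
monomial of degree `d` (and is only used for `j < (monomials w d).length`). -/
def f5Matrix (w : MonomialOrder (Fin n)) (f : Fin s → MvPolynomial (Fin n) K) (deg : Fin s → ℕ)
    (d : ℕ) (i : Fin s) : Matrix (F5Row w f deg d i) ℕ K :=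
  fun r j => (MvPolynomial.monomial r.1.2 (1 : K) * f r.1.1).coeff ((monomials w d).getD j 0)

open Classical in
/-- The largest `l` such that the first `l` columns of the matrix are linearly independent. -/
def freeColumns (w : MonomialOrder (Fin n)) (f : Fin s → MvPolynomial (Fin n) K)
    (deg : Fin s → ℕ) (d : ℕ) (i : Fin s) : ℕ :=
  Nat.findGreatest
    (fun l => LinearIndependent K (fun (j : Fin l) r => f5Matrix w f deg d i r j))
    (monomials w d).length

/-- The minimum of the valuations of the (non-zero) maximal minors on the first
`freeColumns` columns, for polynomials with integral coefficients. -/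
def minorVal (v : AddValuation K (WithTop ℤ)) (w : MonomialOrder (Fin n))
    (f : Fin s → MvPolynomial (Fin n) K) (deg : Fin s → ℕ) (d : ℕ) (i : Fin s) : ℕ :=
  sInf {k : ℕ | ∃ e : Fin (freeColumns w f deg d i) ↪ F5Row w f deg d i,
    v (Matrix.det (fun a b : Fin (freeColumns w f deg d i) =>
      f5Matrix w f deg d i (e a) b)) = ((k : ℤ) : WithTop ℤ)}

/-- The Matrix-F5 precision `max_{d ≤ D, i} minorVal d i` of `f_1, …, f_s`. -/
def precMF5 (v : AddValuation K (WithTop ℤ)) (w : MonomialOrder (Fin n))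
    (f : Fin s → MvPolynomial (Fin n) K) (deg : Fin s → ℕ) (D : ℕ) : ℕ :=
  (Finset.range (D + 1) ×ˢ (Finset.univ : Finset (Fin s))).sup
    fun x => minorVal v w f deg x.1 x.2

end Precision

/-! ## The weak Matrix-F5 algorithm at finite precision -/

section Algorithm

variable {K : Type*} [Field K] {v : AddValuation K (WithTop ℤ)} {n s : ℕ}

/-- A row of a Macaulay matrix: the approximate coefficient in each column. -/
abbrev Row (v : AddValuation K (WithTop ℤ)) (n : ℕ) := Mon n → Approx v

/-- A row of a matrix in echelon form, with the monomial of its first non-zero entry. -/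
structure EchelonRow (v : AddValuation K (WithTop ℤ)) (n : ℕ) where
  lead : Mon n
  row : Row v n

open Classical in
/-- The row of `x ^ α f` when `r` is the row of `f`. -/
def shift (α : Mon n) (r : Row v n) : Row v n :=
  fun u => if α ≤ u then r (u - α) else Approx.exactZero v

open Classical in
/-- Among the given rows, find one whose entry in column `c` is certified to be non-zero and has
the smallest valuation; return it together with the other rows.  Each row costs two operations
(a test to zero and a comparison of valuations). -/
def findPivot (c : Mon n) : List (Row v n) → Counted (Option (Row v n × List (Row v n)))
  | [] => pure none
  | r :: rs => do
    let o ← findPivot c rs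
    charge 2 (match o with
      | none => if (r c).NonzeroCertified then some (r, rs) else none
      | some (p, rs') =>
        if (r c).NonzeroCertified ∧ v (r c).center ≤ v (p c).center
        then some (r, rs) else some (p, r :: rs'))

open Classical in
/-- Replace `r` by `r - q p` in the columns `cs`. -/
def subtractMultiple (m : ℕ) (q : Approx v) (p : Row v n) :
    List (Mon n) → Row v n → Counted (Row v n)
  | [], r => pure r
  | u :: us, r => do
    let x ← charge 1 (Approx.mul m q (p u))
    let y ← charge 1 (Approx.sub m (r u) x)
    subtractMultiple m q p us (Function.update r u y)

open Classical in
/-- Eliminate column `c` of the row `r` with the pivot row `p`: `r ← r - (r c / p c) p` in the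
later columns `cs`, and a real zero in column `c`. -/
def eliminate (m : ℕ) (c : Mon n) (cs : List (Mon n)) (p r : Row v n) : Counted (Row v n) := do
  let q ← charge 1 (Approx.div m (r c) (p c))
  let r' ← subtractMultiple m q p cs r
  pure (Function.update r' c (Approx.exactZero v))

/-- Eliminate column `c` of all the given rows. -/
def eliminateAll (m : ℕ) (c : Mon n) (cs : List (Mon n)) (p : Row v n) :
    List (Row v n) → Counted (List (Row v n))
  | [] => pure []
  | r :: rs => do
    let r' ← eliminate m c cs p r
    let rs' ← eliminateAll m c cs p rs
    pure (r' :: rs')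

/-- Gaussian elimination, column after column, up to the first column without a pivot that is
certified to be non-zero; returns the pivot rows. -/
def gauss (m : ℕ) : List (Mon n) → List (Row v n) → Counted (List (EchelonRow v n))
  | [], _ => pure []
  | c :: cs, M => do
    match ← findPivot c M with
    | none => pure []
    | some (p, rs) => do
      let rs' ← eliminateAll m c cs p rs
      let E ← gauss m cs rs'
      pure (⟨c, p⟩ :: E)

open Classical in
/-- A multiple `X_k P`, with `P` a row of the echelon matrix `prev`, of leading monomial `u`,
if there is one. -/
def findMultiple (prev : List (EchelonRow v n)) (u : Mon n) : Option (EchelonRow v n) :=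
  ((prev.flatMap fun P => (List.finRange n).map fun k =>
    (⟨Finsupp.single k 1 + P.lead, shift (Finsupp.single k 1) P.row⟩ : EchelonRow v n)).filter
      (fun T => decide (T.lead = u))).head?

/-- Complete the pivot rows `E` of a matrix with `N` rows into a matrix in echelon form (up to
permutation) with `N` rows, by multiples of rows of `prev`, with leading monomials in the columns
left `cs`; `none` if this is not possible. -/
def complete (prev E : List (EchelonRow v n)) (N : ℕ) (cs : List (Mon n)) :
    Option (List (EchelonRow v n)) :=
  let T := cs.filterMap (findMultiple prev)
  if N - E.length ≤ T.length then some (E ++ T.take (N - E.length)) else none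

/-- The data of the algorithm: `tilde d i` is the echelon form of the matrix in degree `d` of the
first `i` polynomials (empty for `i = 0`, or if not computed yet), `basis` is the output `G`. -/
structure State (v : AddValuation K (WithTop ℤ)) (n : ℕ) where
  tilde : ℕ → ℕ → List (EchelonRow v n)
  basis : List (EchelonRow v n)

open Classical in
/-- The rows `x ^ α f_i`, `|α| + d_i = d`, such that `x ^ α` is not the leading monomial of a row of
the echelon matrix in degree `d - d_i` of the polynomials before `f_i`. -/
def newRows (w : MonomialOrder (Fin n)) (F : Fin s → APoly v n) (S : State v n) (d : ℕ)
    (i : Fin s) : List (Row v n) :=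
  if (F i).deg ≤ d then
    ((monomials w (d - (F i).deg)).filter (fun α =>
      decide (α ∉ (S.tilde (d - (F i).deg) (i : ℕ)).map EchelonRow.lead))).map
        fun α => shift α (F i).coeff
  else []

open Classical in
/-- The loop over `i` in degree `d`; `M` is the (not reduced) matrix of the previous polynomials.
The value `none` is the error. -/
def innerLoop (m : ℕ) (w : MonomialOrder (Fin n)) (F : Fin s → APoly v n) (d : ℕ) :
    List (Fin s) → List (Row v n) → State v n → Counted (Option (State v n))
  | [], _, S => pure (some S)
  | i :: is, M, S => do
    let M' := M ++ newRows w F S d i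
    let E ← gauss m (monomials w d) M'
    let prev := if d = 0 then [] else S.tilde (d - 1) ((i : ℕ) + 1)
    match complete prev E M'.length ((monomials w d).drop E.length) with
    | none => pure none
    | some E' =>
      let new := E'.filter fun P =>
        decide (P.lead ∉ S.basis.map EchelonRow.lead)
      innerLoop m w F d is M'
        ⟨Function.update S.tilde d (Function.update (S.tilde d) ((i : ℕ) + 1) E'), S.basis ++ new⟩

/-- The loop over the degrees. -/
def outerLoop (m : ℕ) (w : MonomialOrder (Fin n)) (F : Fin s → APoly v n) :
    List ℕ → State v n → Counted (Option (State v n))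
  | [], S => pure (some S)
  | d :: ds, S => do
    match ← innerLoop m w F d (List.finRange s) [] S with
    | none => pure none
    | some S' => outerLoop m w F ds S'

/-- The weak Matrix-F5 algorithm up to degree `D` at working precision `m`; the value `none` is
the error "the ideals are not weakly-`w`, the sequence is not regular, or the precision is not
enough". -/
def weakMF5 (m : ℕ) (w : MonomialOrder (Fin n)) (D : ℕ) (F : Fin s → APoly v n) :
    Counted (Option (List (APoly v n))) := do
  match ← outerLoop m w F (List.range (D + 1)) ⟨fun _ _ => [], []⟩ with
  | none => pure none
  | some S => pure (some (S.basis.map fun P => ⟨P.lead.degree, P.row⟩))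

end Algorithm

end WeakMF5

end

namespace WeakMF5

/-! ## Arithmetic of approximate numbers -/

namespace Approx

variable {K : Type*} [Field K] {v : AddValuation K (WithTop ℤ)}

/-! Coset arithmetic makes a single run of the algorithm valid for all specializations at once, and
dimension counts in each degree show that the run cannot fail. Since `f'` and `f` agree modulo `π ^
m`, they give the same approximate input, so only `f` has to be treated.

Validity. Each approximate operation contains the exact operation on any specializations of its
arguments, and a certified pivot is non-zero for all of them. So every computed row stands, whatever
the specialization, for a homogeneous element of its ideal, always with the same leading monomial
(`gauss_spec`, `GoodRow`).

Precision (`gauss_precise`). Let all coefficients have valuation at least `-c`. A pivot of minimal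
valuation `π` makes the multipliers integral, so this bound persists and treating one column costs
at most `π + 2c` in precision. By Laplace expansion, a minor of valuation `k` on `l` columns leaves,
on the eliminated rows, a minor on `l - 1` columns of valuation at most `k - π`. Hence `k + 2cl +
loss` never increases; staying below `m`, it forces a certified pivot in each of the `freeColumns`
first columns. For integral coefficients, `c = 0` and the loss is at most the valuation of the
initial minor.

Completion (`complete_good`). By regularity, the rows kept by the F5 criterion form a basis of the
degree-`d` part of the ideal, so they are as many as its leading monomials (`length_eq_card_LMdeg`).
A leading monomial beyond the pivots is a multiple of one of degree `d - 1`: otherwise it would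
belong to the reduced Gröbner basis, the weak hypothesis would make all greater monomials leading,
and one more column would be free (`le_freeColumns`). Multiples of earlier rows therefore supply
exactly the missing rows.

Specializations (`LM_le_of_LM_ge`). The rows give the ideals of a specialization at least the
leading monomials of those of `f`. More leading monomials mean fewer rows kept by the criterion, and
these still span, so there cannot be more leading monomials than for `f`. -/

lemma contains_iff (a : Approx v) (x : K) : a.Contains x ↔ a.ord ≤ v (x - a.center) := by
  have h : a.cls = ((a.center : K) : K ⧸ ball v a.ord) := (Quotient.out_eq a.cls).symm
  unfold Contains
  rw [h, QuotientAddGroup.eq, neg_add_eq_sub, v.map_sub_swap]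
  rfl

lemma contains_of_iff (e : WithTop ℤ) (x y : K) : (of v e x).Contains y ↔ e ≤ v (y - x) := by
  change ((y : K ⧸ ball v e) = (x : K ⧸ ball v e)) ↔ _
  rw [QuotientAddGroup.eq, neg_add_eq_sub, v.map_sub_swap]
  rfl

lemma exactZero_contains_iff (x : K) : (exactZero v).Contains x ↔ x = 0 := by
  rw [exactZero, contains_of_iff]
  simp [v.top_iff]

lemma le_val_of_contains {a : Approx v} {x : K} (h : a.Contains x)
    (hc : ¬ a.NonzeroCertified) : a.ord ≤ v x := by
  rw [contains_iff] at h
  have h2 := v.map_add (x - a.center) a.center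
  rw [sub_add_cancel] at h2
  exact le_trans (le_min h (not_lt.1 hc)) h2

lemma val_eq_of_contains {a : Approx v} {x : K} (h : a.Contains x) (hc : a.NonzeroCertified) :
    v x = v a.center := by
  rw [contains_iff] at h
  exact v.map_eq_of_lt_sub (lt_of_lt_of_le hc h)

lemma ne_zero_of_contains {a : Approx v} {x : K} (h : a.Contains x) (hc : a.NonzeroCertified) :
    x ≠ 0 := by
  rintro rfl
  have h1 := val_eq_of_contains h hc
  have h2 : v a.center < a.ord := hc
  rw [← h1, v.map_zero] at h2
  exact not_top_lt h2

lemma nonzeroCertified_of_lt {a : Approx v} {x : K} (h : a.Contains x) (hx : v x < a.ord) :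
    a.NonzeroCertified := by
  by_contra hc
  exact absurd (le_val_of_contains h hc) (not_le.2 hx)

/-- The representative differs from the number by an element of `O(π ^ ord)`, whence the cap `j ≤
a.ord`. This carries bounds from exact values to the representatives that enter the precision
formulas. -/
lemma le_val_center {a : Approx v} {x : K} {j : WithTop ℤ} (h : a.Contains x) (hx : j ≤ v x)
    (hj : j ≤ a.ord) : j ≤ v a.center := by
  rw [contains_iff] at h
  have h2 := v.map_sub x (x - a.center)
  rw [sub_sub_cancel] at h2
  exact le_trans (le_min hx (hj.trans h)) h2

lemma round_contains {m : ℕ} {e : WithTop ℤ} {x y : K} (h : e ≤ v (y - x)) :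
    (round v m e x).Contains y := by
  rw [round, contains_of_iff]
  split_ifs with he
  · exact he ▸ h
  · exact (min_le_left _ _).trans h

lemma sub_contains {m : ℕ} {a b : Approx v} {x y : K} (ha : a.Contains x) (hb : b.Contains y) :
    (sub m a b).Contains (x - y) := by
  rw [contains_iff] at ha hb
  apply round_contains
  rw [sub_sub_sub_comm]
  exact (min_le_min ha hb).trans (v.map_sub _ _)

lemma mul_contains {m : ℕ} {a b : Approx v} {x y : K} (ha : a.Contains x) (hb : b.Contains y) :
    (mul m a b).Contains (x * y) := by
  rw [contains_iff] at ha hb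
  apply round_contains
  have h : x * y - a.center * b.center = a.center * (y - b.center) +
      (b.center * (x - a.center) + (x - a.center) * (y - b.center)) := by ring
  rw [h]
  refine le_trans (min_le_min ?_ (le_trans (min_le_min ?_ ?_) (v.map_add _ _))) (v.map_add _ _)
  all_goals rw [v.map_mul]; gcongr

lemma div_contains {m : ℕ} {a b : Approx v} {x y : K} (ha : a.Contains x) (hb : b.Contains y)
    (hc : b.NonzeroCertified) : (div m a b).Contains (x / y) := by
  have hy := ne_zero_of_contains hb hc
  have hv := val_eq_of_contains hb hc
  have hb0 : b.center ≠ 0 := by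
    intro h0
    rw [h0, v.map_zero, v.top_iff] at hv
    exact hy hv
  have hinv : v y⁻¹ = v b.center⁻¹ := by rw [v.map_inv, v.map_inv, hv]
  rw [contains_iff] at ha hb
  apply round_contains
  -- The two error terms match the two terms of the minimum in `div`.
  have h : x / y - a.center / b.center = (x - a.center) * y⁻¹ -
      (y - b.center) * a.center * y⁻¹ * b.center⁻¹ := by
    field_simp
    ring
  rw [h]
  refine le_trans (min_le_min ?_ ?_) (v.map_sub _ _)
  · rw [v.map_mul, hinv]; gcongr
  · rw [v.map_mul, v.map_mul, v.map_mul, hinv]; gcongr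

lemma le_ord_round {m : ℕ} {k : ℤ} {e : WithTop ℤ} {x : K} (h : (k : WithTop ℤ) ≤ e)
    (hm : k ≤ m) : (k : WithTop ℤ) ≤ (round v m e x).ord := by
  change (k : WithTop ℤ) ≤ if e = ⊤ then ⊤ else min e ((m : ℤ) : WithTop ℤ)
  split_ifs with he
  · exact le_top
  · exact le_min h (by exact_mod_cast hm)

lemma le_ord_sub {m : ℕ} {k : ℤ} {a b : Approx v} (ha : (k : WithTop ℤ) ≤ a.ord)
    (hb : (k : WithTop ℤ) ≤ b.ord) (hm : k ≤ m) : (k : WithTop ℤ) ≤ (sub m a b).ord :=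
  le_ord_round (le_min ha hb) hm

lemma coe_le_add {k i j : ℤ} {a b : WithTop ℤ} (hi : (i : WithTop ℤ) ≤ a)
    (hj : (j : WithTop ℤ) ≤ b) (h : k ≤ i + j) : (k : WithTop ℤ) ≤ a + b :=
  le_trans (by exact_mod_cast h) (add_le_add hi hj)

lemma le_ord_mul {m : ℕ} {k i j e e' : ℤ} {a b : Approx v} (hi : (i : WithTop ℤ) ≤ v a.center)
    (hj : (j : WithTop ℤ) ≤ v b.center) (he : (e : WithTop ℤ) ≤ a.ord)
    (he' : (e' : WithTop ℤ) ≤ b.ord) (h1 : k ≤ i + e') (h2 : k ≤ j + e) (h3 : k ≤ e + e')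
    (hm : k ≤ m) : (k : WithTop ℤ) ≤ (mul m a b).ord :=
  le_ord_round (le_min (coe_le_add hi he' h1) (le_min (coe_le_add hj he h2)
    (coe_le_add he he' h3))) hm

lemma val_inv_eq {x : K} {a : ℤ} (h : v x = a) : v x⁻¹ = ((-a : ℤ) : WithTop ℤ) := by
  rw [v.map_inv, h]
  rfl

lemma le_ord_div {m : ℕ} {k e a : ℤ} {r p : Approx v} (hp : v p.center = a)
    (hr : (e : WithTop ℤ) ≤ r.ord) (hpo : (e : WithTop ℤ) ≤ p.ord)
    (hra : (a : WithTop ℤ) ≤ v r.center) (hk : k ≤ e - a) (hm : k ≤ m) :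
    (k : WithTop ℤ) ≤ (div m r p).ord := by
  have hinv := (val_inv_eq hp).ge
  refine le_ord_round (le_min (coe_le_add hr hinv (by omega)) ?_) hm
  exact coe_le_add (i := e + a + -a) (coe_le_add (i := e + a) (coe_le_add hpo hra le_rfl) hinv
    le_rfl) hinv (by omega)

lemma le_val_div {x y : K} {a : ℤ} (hy : v y = a) (hx : (a : WithTop ℤ) ≤ v x) :
    (0 : WithTop ℤ) ≤ v (x / y) := by
  rw [div_eq_mul_inv, v.map_mul]
  exact coe_le_add hx (val_inv_eq hy).ge (by omega)

/-- Loss of precision in one elimination step `r u - (r c / p c) * p u`. -/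
lemma le_ord_elimination {m : ℕ} {c e a : ℤ} {r₀ p₀ r p : Approx v} {x₀ y₀ y : K}
    (hr₀ : r₀.Contains x₀) (hp₀ : p₀.Contains y₀) (hp : p.Contains y)
    (hcert : p₀.NonzeroCertified) (hy₀ : v y₀ = a) (hx₀ : (a : WithTop ℤ) ≤ v x₀)
    (hy : ((-c : ℤ) : WithTop ℤ) ≤ v y) (hor₀ : (e : WithTop ℤ) ≤ r₀.ord)
    (hop₀ : (e : WithTop ℤ) ≤ p₀.ord) (hor : (e : WithTop ℤ) ≤ r.ord)
    (hop : (e : WithTop ℤ) ≤ p.ord) (hae : a < e) (hem : e ≤ m) (hc : 0 ≤ c) (hca : -c ≤ a) :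
    ((e - (a + 2 * c) : ℤ) : WithTop ℤ) ≤ (sub m r (mul m (div m r₀ p₀) p)).ord := by
  have hcoe : ∀ {i j : ℤ} {o : WithTop ℤ}, (j : WithTop ℤ) ≤ o → i ≤ j → (i : WithTop ℤ) ≤ o :=
    fun h hij => le_trans (by exact_mod_cast hij) h
  -- Rounding caps the quotient at `m`, which matters when `a < 0`. Multiplying by an entry of
  -- valuation at least `-c` then leaves order `-c + min (e - a) m`; the second `c` in the loss pays
  -- for the cap.
  have hq : ((min (e - a) m : ℤ) : WithTop ℤ) ≤ (div m r₀ p₀).ord :=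
    le_ord_div ((val_eq_of_contains hp₀ hcert).symm.trans hy₀) hor₀ hop₀
      (le_val_center hr₀ hx₀ (hcoe hor₀ hae.le)) (min_le_left _ _) (min_le_right _ _)
  have hqc : ((0 : ℤ) : WithTop ℤ) ≤ v (div m r₀ p₀).center :=
    le_val_center (div_contains hr₀ hp₀ hcert) (le_val_div hy₀ hx₀) (hcoe hq (by omega))
  have hpc : ((-c : ℤ) : WithTop ℤ) ≤ v p.center :=
    le_val_center hp hy (hcoe hop (by omega))
  exact le_ord_sub (hcoe hor (by omega))
    (le_ord_mul hqc hpc hq hop (by omega) (by omega) (by omega) (by omega)) (by omega)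

end Approx

/-! ## Gaussian elimination -/

section Counted

universe u

variable {α β : Type u}

@[simp] lemma Counted.val_pure (a : α) : (pure a : Counted α).val = a := rfl
@[simp] lemma Counted.cost_pure (a : α) : (pure a : Counted α).cost = 0 := rfl
@[simp] lemma Counted.val_bind (x : Counted α) (f : α → Counted β) :
    (x >>= f).val = (f x.val).val := rfl
@[simp] lemma Counted.cost_bind (x : Counted α) (f : α → Counted β) :
    (x >>= f).cost = x.cost + (f x.val).cost := rfl
@[simp] lemma val_charge (k : ℕ) (a : α) : (charge k a).val = a := rfl
@[simp] lemma cost_charge (k : ℕ) (a : α) : (charge k a).cost = k := rfl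

end Counted

section Gauss

open Approx MvPolynomial

variable {K : Type*} [Field K] {v : AddValuation K (WithTop ℤ)} {n : ℕ}

/-! ### Pivot search. -/

lemma cost_findPivot (c : Mon n) (M : List (Row v n)) :
    (findPivot c M).cost = 2 * M.length := by
  induction M with
  | nil => simp [findPivot]
  | cons r rs ih => simp [findPivot, ih]; omega

lemma findPivot_none {c : Mon n} {M : List (Row v n)} (h : (findPivot c M).val = none) :
    ∀ r ∈ M, ¬ (r c).NonzeroCertified := by
  induction M with
  | nil => simp
  | cons r rs ih =>
    simp only [findPivot, Counted.val_bind, val_charge] at h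
    rcases ho : (findPivot c rs).val with _ | ⟨p, rs'⟩
    · rw [ho] at h
      simp only at h
      split_ifs at h with hc
      simpa using ⟨hc, ih ho⟩
    · rw [ho] at h
      simp only at h
      split_ifs at h

lemma findPivot_some {c : Mon n} {M rest : List (Row v n)} {p : Row v n}
    (h : (findPivot c M).val = some (p, rest)) :
    (∃ M₁ M₂, M = M₁ ++ p :: M₂ ∧ rest = M₁ ++ M₂) ∧ (p c).NonzeroCertified ∧
      ∀ r ∈ M, (r c).NonzeroCertified → v (p c).center ≤ v (r c).center := by
  induction M generalizing p rest with
  | nil => simp [findPivot] at h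
  | cons r rs ih =>
    simp only [findPivot, Counted.val_bind, val_charge] at h
    rcases ho : (findPivot c rs).val with _ | ⟨q, rs'⟩
    · rw [ho] at h
      simp only at h
      split_ifs at h with hc
      simp only [Option.some.injEq, Prod.mk.injEq] at h
      obtain ⟨rfl, rfl⟩ := h
      refine ⟨⟨[], rs, rfl, rfl⟩, hc, ?_⟩
      intro r' hr' hc'
      rcases List.mem_cons.1 hr' with rfl | hr'
      · exact le_rfl
      · exact absurd hc' (findPivot_none ho r' hr')
    · rw [ho] at h
      obtain ⟨⟨M₁, M₂, rfl, rfl⟩, hq, hmin⟩ := ih ho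
      simp only at h
      split_ifs at h with hc
      · simp only [Option.some.injEq, Prod.mk.injEq] at h
        obtain ⟨rfl, rfl⟩ := h
        refine ⟨⟨[], _, rfl, rfl⟩, hc.1, ?_⟩
        intro r' hr' hc'
        rcases List.mem_cons.1 hr' with rfl | hr'
        · exact le_rfl
        · exact hc.2.trans (hmin r' hr' hc')
      · simp only [Option.some.injEq, Prod.mk.injEq] at h
        obtain ⟨rfl, rfl⟩ := h
        refine ⟨⟨r :: M₁, M₂, rfl, rfl⟩, hq, ?_⟩
        intro r' hr' hc'
        rcases List.mem_cons.1 hr' with rfl | hr'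
        · by_contra hlt
          exact hc ⟨hc', (not_le.1 hlt).le⟩
        · exact hmin r' hr' hc'

/-! ### Elimination of one column: entries and operation counts. -/

lemma cost_subtractMultiple (m : ℕ) (q : Approx v) (p : Row v n) (cs : List (Mon n))
    (r : Row v n) : (subtractMultiple m q p cs r).cost = 2 * cs.length := by
  induction cs generalizing r with
  | nil => simp [subtractMultiple]
  | cons u us ih => simp [subtractMultiple, ih]; omega

-- As no column is repeated, each entry is updated once, from its original value.
open Classical in
lemma val_subtractMultiple (m : ℕ) (q : Approx v) (p : Row v n) {cs : List (Mon n)}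
    (hcs : cs.Nodup) (r : Row v n) (u : Mon n) :
    (subtractMultiple m q p cs r).val u =
      if u ∈ cs then Approx.sub m (r u) (Approx.mul m q (p u)) else r u := by
  induction cs generalizing r with
  | nil => simp [subtractMultiple]
  | cons u' us ih =>
    rw [List.nodup_cons] at hcs
    simp only [subtractMultiple, Counted.val_bind, val_charge]
    rw [ih hcs.2]
    by_cases hu : u = u'
    · subst hu
      simp [hcs.1]
    · simp [hu]

lemma cost_eliminate (m : ℕ) (c : Mon n) (cs : List (Mon n)) (p r : Row v n) :
    (eliminate m c cs p r).cost = 1 + 2 * cs.length := by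
  simp [eliminate, cost_subtractMultiple]

open Classical in
lemma val_eliminate (m : ℕ) {c : Mon n} {cs : List (Mon n)} (hcs : (c :: cs).Nodup)
    (p r : Row v n) (u : Mon n) :
    (eliminate m c cs p r).val u =
      if u = c then exactZero v else
      if u ∈ cs then Approx.sub m (r u) (Approx.mul m (Approx.div m (r c) (p c)) (p u))
      else r u := by
  simp only [eliminate, Counted.val_bind, val_charge, Counted.val_pure]
  by_cases hu : u = c
  · simp [hu]
  · simp [hu, val_subtractMultiple m _ p (List.nodup_cons.1 hcs).2]

lemma val_eliminateAll (m : ℕ) (c : Mon n) (cs : List (Mon n)) (p : Row v n)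
    (M : List (Row v n)) :
    (eliminateAll m c cs p M).val = M.map fun r => (eliminate m c cs p r).val := by
  induction M with
  | nil => rfl
  | cons r rs ih => simp [eliminateAll, ih]

lemma cost_eliminateAll (m : ℕ) (c : Mon n) (cs : List (Mon n)) (p : Row v n)
    (M : List (Row v n)) :
    (eliminateAll m c cs p M).cost = M.length * (1 + 2 * cs.length) := by
  induction M with
  | nil => simp [eliminateAll]
  | cons r rs ih => simp [eliminateAll, ih, cost_eliminate]; ring

/-! ### The recursion of Gaussian elimination. -/

lemma val_gauss_cons_none (m : ℕ) {c : Mon n} (cs : List (Mon n)) {M : List (Row v n)}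
    (h : (findPivot c M).val = none) : (gauss m (c :: cs) M).val = [] := by
  simp [gauss, h]

lemma val_gauss_cons_some (m : ℕ) {c : Mon n} (cs : List (Mon n)) {M rest : List (Row v n)}
    {p : Row v n} (h : (findPivot c M).val = some (p, rest)) :
    (gauss m (c :: cs) M).val =
      ⟨c, p⟩ :: (gauss m cs (rest.map fun r => (eliminate m c cs p r).val)).val := by
  simp [gauss, h, val_eliminateAll]

lemma cost_gauss_le (m : ℕ) (cs : List (Mon n)) (M : List (Row v n)) :
    (gauss m cs M).cost ≤ cs.length * (M.length * (2 * cs.length + 3)) := by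
  induction cs generalizing M with
  | nil => simp [gauss]
  | cons c cs ih =>
    rcases h : (findPivot c M).val with _ | ⟨p, rest⟩
    · simp only [gauss, Counted.cost_bind, cost_findPivot, h, Counted.cost_pure, List.length_cons]
      nlinarith [Nat.zero_le (M.length * cs.length), Nat.zero_le (M.length * cs.length * cs.length)]
    · obtain ⟨⟨M₁, M₂, rfl, rfl⟩, -, -⟩ := findPivot_some h
      simp only [gauss, Counted.cost_bind, cost_findPivot, h, Counted.cost_pure, List.length_cons,
        cost_eliminateAll]
      have := ih (M := (eliminateAll m c cs p (M₁ ++ M₂)).val)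
      rw [val_eliminateAll, List.length_map] at this
      rw [val_eliminateAll]
      have h1 : (M₁ ++ p :: M₂).length = (M₁ ++ M₂).length + 1 := by simp; omega
      rw [h1]
      generalize (M₁ ++ M₂).length = a at *
      generalize cs.length = b at *
      nlinarith

/-- Elimination stops at the first column without a certified pivot, so no column is skipped. -/
lemma gauss_leads_prefix (m : ℕ) (cs : List (Mon n)) (M : List (Row v n)) :
    (gauss m cs M).val.map EchelonRow.lead <+: cs := by
  induction cs generalizing M with
  | nil => simp [gauss]
  | cons c cs ih =>
    rcases h : (findPivot c M).val with _ | ⟨p, rest⟩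
    · simp [val_gauss_cons_none m cs h]
    · rw [val_gauss_cons_some m cs h, List.map_cons, List.cons_prefix_cons]
      exact ⟨rfl, ih _⟩

/-- The polynomial `x` is, in degree `d`, one of those that `r` may stand for. -/
def RowContains (d : ℕ) (r : Row v n) (x : MvPolynomial (Fin n) K) : Prop :=
  ∀ u : Mon n, u.degree = d → (r u).Contains (x.coeff u)

/-- One exact elimination step. -/
noncomputable def elimPoly (c : Mon n) (y x : MvPolynomial (Fin n) K) : MvPolynomial (Fin n) K :=
  x - (x.coeff c / y.coeff c) • y

lemma coeff_elimPoly (c : Mon n) (y x : MvPolynomial (Fin n) K) (u : Mon n) :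
    (elimPoly c y x).coeff u = x.coeff u - x.coeff c / y.coeff c * y.coeff u := by
  simp [elimPoly]

/-- The exact zero written in column `c` is correct for every specialization because the pivot is
non-zero for all of them. In columns outside `c :: cs` the pivot row is exactly zero by `hz`, so
leaving `r` unchanged there is also correct. -/
lemma eliminate_contains {m d : ℕ} {c : Mon n} {cs : List (Mon n)} (hcs : (c :: cs).Nodup)
    (hd : c.degree = d) {p r : Row v n} {y x : MvPolynomial (Fin n) K}
    (hc : (p c).NonzeroCertified) (hp : RowContains d p y) (hr : RowContains d r x)
    (hz : ∀ u : Mon n, u.degree = d → u ∉ c :: cs → p u = exactZero v) :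
    RowContains d (eliminate m c cs p r).val (elimPoly c y x) := by
  intro u hu
  rw [val_eliminate m hcs, coeff_elimPoly]
  split_ifs with h1 h2
  · subst h1
    rw [exactZero_contains_iff, div_mul_cancel₀ _ (ne_zero_of_contains (hp u hu) hc), sub_self]
  · exact sub_contains (hr u hu) (mul_contains (div_contains (hr c hd) (hp c hd) hc) (hp u hu))
  · have h0 := hp u hu
    rw [hz u hu (by simp [h1, h2]), exactZero_contains_iff] at h0
    rw [h0, mul_zero, sub_zero]
    exact hr u hu

lemma eliminate_zero {m d : ℕ} {c : Mon n} {cs : List (Mon n)} (hcs : (c :: cs).Nodup)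
    {p r : Row v n} (hz : ∀ u : Mon n, u.degree = d → u ∉ c :: cs → r u = exactZero v) :
    ∀ u : Mon n, u.degree = d → u ∉ cs → (eliminate m c cs p r).val u = exactZero v := by
  intro u hu hucs
  rw [val_eliminate m hcs]
  split_ifs with h1
  · rfl
  · exact hz u hu (by simp [h1, hucs])

/-- Meant for `V` the degree-`d` part of the ideal of an arbitrary specialization. The run does not
depend on `V`, so the same output rows serve all specializations. -/
lemma gauss_spec (m : ℕ) {d : ℕ} (V : Submodule K (MvPolynomial (Fin n) K)) {cs : List (Mon n)}
    (hcs : cs.Nodup) (hd : ∀ u ∈ cs, u.degree = d) {M : List (Row v n)}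
    (hM : ∀ r ∈ M, ∃ x ∈ V, RowContains d r x)
    (hz : ∀ r ∈ M, ∀ u : Mon n, u.degree = d → u ∉ cs → r u = exactZero v) :
    ∀ Q ∈ (gauss m cs M).val, (Q.row Q.lead).NonzeroCertified ∧
      ∃ x ∈ V, RowContains d Q.row x := by
  induction cs generalizing M with
  | nil => simp [gauss]
  | cons c cs ih =>
    rcases h : (findPivot c M).val with _ | ⟨p, rest⟩
    · simp [val_gauss_cons_none m cs h]
    · rw [val_gauss_cons_some m cs h]
      obtain ⟨⟨M₁, M₂, hM', rfl⟩, hc, -⟩ := findPivot_some h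
      have hpM : p ∈ M := by simp [hM']
      have hsub : ∀ r ∈ M₁ ++ M₂, r ∈ M := by
        intro r hr
        rw [hM']
        simp only [List.mem_append, List.mem_cons] at hr ⊢
        tauto
      obtain ⟨y, hyV, hy⟩ := hM p hpM
      intro Q hQ
      rcases List.mem_cons.1 hQ with rfl | hQ
      · exact ⟨hc, y, hyV, hy⟩
      · refine ih (List.nodup_cons.1 hcs).2 (fun u hu => hd u (by simp [hu])) ?_ ?_ Q hQ
        · intro r' hr'
          obtain ⟨r, hr, rfl⟩ := List.mem_map.1 hr'
          obtain ⟨x, hxV, hx⟩ := hM r (hsub r hr)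
          exact ⟨elimPoly c y x, V.sub_mem hxV (V.smul_mem _ hyV),
            eliminate_contains hcs (hd c (by simp)) hc hy hx (hz p hpM)⟩
        · intro r' hr'
          obtain ⟨r, hr, rfl⟩ := List.mem_map.1 hr'
          exact eliminate_zero hcs (hz r (hsub r hr))

/-- Columns are treated in decreasing order, and every treated column holds exact zeros in the
remaining rows. -/
lemma gauss_zero (m : ℕ) {d : ℕ} {γ : Type*} [Preorder γ] (o : Mon n → γ) {cs : List (Mon n)}
    (hcs : cs.Nodup) (hs : cs.Pairwise fun a b => o b < o a) {M : List (Row v n)}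
    (hz : ∀ r ∈ M, ∀ u : Mon n, u.degree = d → u ∉ cs → r u = exactZero v) :
    ∀ Q ∈ (gauss m cs M).val, ∀ u : Mon n, u.degree = d → o Q.lead < o u →
      Q.row u = exactZero v := by
  induction cs generalizing M with
  | nil => simp [gauss]
  | cons c cs ih =>
    rcases h : (findPivot c M).val with _ | ⟨p, rest⟩
    · simp [val_gauss_cons_none m cs h]
    · rw [val_gauss_cons_some m cs h]
      obtain ⟨⟨M₁, M₂, hM', rfl⟩, hc, -⟩ := findPivot_some h
      rw [List.pairwise_cons] at hs
      intro Q hQ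
      rcases List.mem_cons.1 hQ with rfl | hQ
      · intro u hu hlt
        refine hz p (by simp [hM']) u hu ?_
        rw [List.mem_cons]
        rintro (rfl | hmem)
        · exact lt_irrefl _ hlt
        · exact lt_asymm hlt (hs.1 u hmem)
      · refine ih (List.nodup_cons.1 hcs).2 hs.2 ?_ Q hQ
        intro r' hr'
        obtain ⟨r, hr, rfl⟩ := List.mem_map.1 hr'
        refine eliminate_zero hcs (hz r ?_)
        rw [hM']
        simp only [List.mem_append, List.mem_cons] at hr ⊢
        tauto

end Gauss

section Precision

open Approx MvPolynomial

variable {K : Type*} [Field K] {v : AddValuation K (WithTop ℤ)} {n : ℕ}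

/-! ## Loss of precision in Gaussian elimination -/

/-- Ultrametric inequality in the Laplace expansion along the first column: some term has valuation
at most that of the sum. -/
lemma exists_val_minor_le {l : ℕ} (A : Matrix (Fin (l + 1)) (Fin (l + 1)) K) :
    ∃ a, v (A a 0) + v (A.submatrix a.succAbove Fin.succ).det ≤ v A.det := by
  by_contra! h
  have htop : v A.det ≠ ⊤ := fun ht => by
    have := h 0
    rw [ht] at this
    exact not_top_lt this
  have : v A.det < v A.det := by
    conv_rhs => rw [Matrix.det_succ_column_zero]
    refine v.map_lt_sum htop fun i _ => ?_
    rw [v.map_mul, v.map_mul, v.map_pow, v.map_neg, v.map_one, smul_zero, zero_add]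
    exact h i
  exact lt_irrefl _ this

lemma le_val_det {l : ℕ} (c : ℤ) (A : Matrix (Fin l) (Fin l) K)
    (hA : ∀ a b, ((-c : ℤ) : WithTop ℤ) ≤ v (A a b)) :
    ((-(l * c) : ℤ) : WithTop ℤ) ≤ v A.det := by
  induction l with
  | zero => simp
  | succ l ih =>
    rw [Matrix.det_succ_column_zero]
    refine v.map_le_sum fun i _ => ?_
    rw [v.map_mul, v.map_mul, v.map_pow, v.map_neg, v.map_one, smul_zero, zero_add]
    refine coe_le_add (hA i 0) (ih _ fun a b => hA _ _) ?_
    push_cast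
    linarith

/-- Subtracting `q y` times the first column from the later ones keeps the determinant and turns the
rows into eliminated rows; then expand along the first column. The row that provides `q` need not be
a row of `A`. -/
lemma exists_val_eliminated_minor_le {l : ℕ} (A : Matrix (Fin (l + 1)) (Fin (l + 1)) K)
    (q : Fin l → K) {π : WithTop ℤ} (hπ : ∀ a, π ≤ v (A a 0)) :
    ∃ a : Fin (l + 1), π + v (Matrix.det fun x y : Fin l =>
      A (a.succAbove x) y.succ - A (a.succAbove x) 0 * q y) ≤ v A.det := by
  let B : Matrix (Fin (l + 1)) (Fin (l + 1)) K :=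
    fun a b => A a b - A a 0 * (Fin.cons 0 q : Fin (l + 1) → K) b
  have hdet : B.det = A.det := by
    rw [← Matrix.det_transpose B, ← Matrix.det_transpose A]
    refine Matrix.det_eq_of_forall_row_eq_smul_add_const (-(Fin.cons 0 q : Fin (l + 1) → K)) 0
      (by simp) fun i j => ?_
    change A j i - A j 0 * _ = A j i + -_ * A j 0
    ring
  obtain ⟨a, ha⟩ := exists_val_minor_le (v := v) B
  refine ⟨a, ?_⟩
  rw [hdet] at ha
  refine le_trans (add_le_add ?_ (le_of_eq ?_)) ha
  · simpa [B] using hπ a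
  · congr 2

lemma le_of_add_le {a b : WithTop ℤ} {k j : ℤ} (h : a + b ≤ k) (hb : ((-j : ℤ) : WithTop ℤ) ≤ b) :
    a ≤ ((k + j : ℤ) : WithTop ℤ) := by
  induction a with
  | top => simp at h
  | coe a =>
    induction b with
    | top => simp at h
    | coe b =>
      norm_cast at h hb ⊢
      omega

-- Induction on the columns, pairing each approximate row with an exact polynomial it contains. Here
-- `σ` is the precision already lost and `k` the valuation of a minor on the next `l` columns; the
-- budget `k + 2cl + σ ≤ P` survives each elimination. The minor serves only as a witness: its rows
-- need not be the ones chosen as pivots.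
set_option maxHeartbeats 1000000 in
lemma gauss_precise {m d : ℕ} {c P : ℤ} (hc : 0 ≤ c) (hPm : P < m) {cs : List (Mon n)}
    (hcs : cs.Nodup) (hd : ∀ u ∈ cs, u.degree = d) {l : ℕ} (hl : l ≤ cs.length) {σ : ℤ}
    (hσ : 0 ≤ σ) {W : List (Row v n × MvPolynomial (Fin n) K)}
    (hz : ∀ w ∈ W, ∀ u : Mon n, u.degree = d → u ∉ cs → w.1 u = exactZero v)
    (hW : ∀ w ∈ W, RowContains d w.1 w.2)
    (hval : ∀ w ∈ W, ∀ u : Mon n, u.degree = d → ((-c : ℤ) : WithTop ℤ) ≤ v (w.2.coeff u))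
    (hord : ∀ w ∈ W, ∀ u : Mon n, u.degree = d → ((m - σ : ℤ) : WithTop ℤ) ≤ (w.1 u).ord)
    {e : Fin l → Row v n × MvPolynomial (Fin n) K} (he : ∀ a, e a ∈ W) {k : ℤ}
    (hdet : v (Matrix.det fun a b : Fin l => (e a).2.coeff (cs.getD b 0)) = k)
    (hk : k + l * (2 * c) + σ ≤ P) :
    l ≤ (gauss m cs (W.map Prod.fst)).val.length ∧
      ∀ Q ∈ (gauss m cs (W.map Prod.fst)).val.take l, ∀ u : Mon n, u.degree = d →
        ((m - P : ℤ) : WithTop ℤ) ≤ (Q.row u).ord := by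
  induction cs generalizing l σ W k with
  | nil =>
    obtain rfl : l = 0 := by simpa using hl
    simp
  | cons c₀ cs ih =>
    rcases l with _ | l
    · simp
    have hlc : 0 ≤ (l : ℤ) * c := by positivity
    push_cast at hk
    have hd₀ : c₀.degree = d := hd c₀ (by simp)
    obtain ⟨a₀, ha₀⟩ := exists_val_minor_le (v := v)
      (fun a b : Fin (l + 1) => (e a).2.coeff ((c₀ :: cs).getD b 0))
    rw [hdet] at ha₀
    -- The complementary `l × l` minor has valuation at least `-lc`, so the entry in front of it
    -- cannot have large valuation.
    have ha₀' : v ((e a₀).2.coeff c₀) ≤ ((k + l * c : ℤ) : WithTop ℤ) := by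
      refine le_of_add_le ha₀ (le_val_det c _ fun a b => hval _ (he _) _ ?_)
      have hb : (b.succ : ℕ) < (c₀ :: cs).length := lt_of_lt_of_le b.succ.2 hl
      rw [List.getD_eq_getElem _ _ hb]
      exact hd _ (List.getElem_mem hb)
    have hkm : k + l * c < m - σ := by linarith
    have hcert₀ : ((e a₀).1 c₀).NonzeroCertified := by
      refine nonzeroCertified_of_lt (hW _ (he _) _ hd₀) (lt_of_le_of_lt ha₀' ?_)
      refine lt_of_lt_of_le ?_ (hord _ (he a₀) _ hd₀)
      exact_mod_cast hkm
    rcases h : (findPivot c₀ (W.map Prod.fst)).val with _ | ⟨p, rest⟩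
    · exact absurd hcert₀ (findPivot_none h _ (List.mem_map_of_mem (he a₀)))
    rw [val_gauss_cons_some m cs h]
    obtain ⟨⟨M₁, M₂, hM, rfl⟩, hcert, hmin⟩ := findPivot_some h
    obtain ⟨W₁, W', rfl, rfl, hW'⟩ := List.map_eq_append_iff.1 hM
    obtain ⟨⟨p', y⟩, W₂, rfl, rfl, rfl⟩ := List.map_eq_cons_iff.1 hW'
    simp only at h hcert hmin ⊢
    have hpW : (p', y) ∈ W₁ ++ (p', y) :: W₂ := by simp
    have hpc := hW _ hpW _ hd₀
    have hvy := val_eq_of_contains hpc hcert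
    obtain ⟨π, hπ⟩ := WithTop.ne_top_iff_exists.1
      (mt v.top_iff.1 (ne_zero_of_contains hpc hcert))
    have hπk : π ≤ k + l * c := by
      have h1 := hmin _ (List.mem_map_of_mem (he a₀)) hcert₀
      rw [← hvy, ← val_eq_of_contains (hW _ (he a₀) _ hd₀) hcert₀] at h1
      have h2 := h1.trans ha₀'
      rw [← hπ] at h2
      exact_mod_cast h2
    have hcπ : -c ≤ π := by
      have h1 := hval _ hpW _ hd₀
      rw [← hπ] at h1
      exact_mod_cast h1
    -- The pivot is minimal also among the entries that are not certified: the valuation of those is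
    -- at least their precision `m - σ`, which exceeds `π`.
    have hπmin : ∀ w ∈ W₁ ++ (p', y) :: W₂, (π : WithTop ℤ) ≤ v (w.2.coeff c₀) := by
      intro w hw
      by_cases hcw : (w.1 c₀).NonzeroCertified
      · have h1 := hmin _ (List.mem_map_of_mem hw) hcw
        rwa [← hvy, ← val_eq_of_contains (hW _ hw _ hd₀) hcw, ← hπ] at h1
      · refine le_trans ?_ ((hord _ hw _ hd₀).trans (le_val_of_contains (hW _ hw _ hd₀) hcw))
        exact_mod_cast (hπk.trans_lt hkm).le
    have hcoeff : ∀ (x : MvPolynomial (Fin n) K) (u : Mon n), (elimPoly c₀ y x).coeff u =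
        x.coeff u - x.coeff c₀ * (y.coeff u / y.coeff c₀) := by
      intro x u
      rw [coeff_elimPoly]
      ring
    obtain ⟨a₁, ha₁⟩ := exists_val_eliminated_minor_le (v := v)
      (fun a b : Fin (l + 1) => (e a).2.coeff ((c₀ :: cs).getD b 0))
      (fun b => y.coeff (cs.getD b 0) / y.coeff c₀) (fun a => hπmin _ (he a))
    rw [hdet] at ha₁
    simp only [Fin.val_succ, List.getD_cons_succ, Fin.val_zero, List.getD_cons_zero,
      ← hcoeff] at ha₁
    have hfin : v (Matrix.det fun x b : Fin l =>
        (elimPoly c₀ y (e (a₁.succAbove x)).2).coeff (cs.getD b 0)) ≠ ⊤ := by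
      intro ht
      rw [ht] at ha₁
      simp at ha₁
    obtain ⟨k', hk'⟩ := WithTop.ne_top_iff_exists.1 hfin
    have hkk : π + k' ≤ k := by
      rw [← hk'] at ha₁
      exact_mod_cast ha₁
    have hsub : ∀ w ∈ W₁ ++ W₂, w ∈ W₁ ++ (p', y) :: W₂ := by
      intro w hw
      simp only [List.mem_append, List.mem_cons] at hw ⊢
      tauto
    have hmem : ∀ x : Fin l, e (a₁.succAbove x) ∈ W₁ ++ W₂ := by
      intro x
      have h1 := he (a₁.succAbove x)
      simp only [List.mem_append, List.mem_cons] at h1 ⊢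
      rcases h1 with h1 | h1 | h1
      · exact Or.inl h1
      -- The pivot row cannot occur here: eliminated by itself it is zero, and the new minor would
      -- vanish.
      · exfalso
        apply hfin
        rw [v.top_iff]
        refine Matrix.det_eq_zero_of_row_eq_zero x fun b => ?_
        rw [h1, coeff_elimPoly, div_self (ne_zero_of_contains hpc hcert), one_mul, sub_self]
      · exact Or.inr h1
    obtain ⟨F, hF⟩ : ∃ F : Row v n × MvPolynomial (Fin n) K → Row v n × MvPolynomial (Fin n) K,
        ∀ w, F w = ((eliminate m c₀ cs p' w.1).val, elimPoly c₀ y w.2) := ⟨_, fun _ => rfl⟩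
    have hrest : ((W₁.map Prod.fst ++ W₂.map Prod.fst).map fun r =>
        (eliminate m c₀ cs p' r).val) =
        ((W₁ ++ W₂).map F).map Prod.fst := by
      simp [Function.comp_def, hF]
    rw [hrest]
    -- The budget is kept: `l` drops by one, `σ` grows by `π + 2c`, and `k' ≤ k - π`.
    have key := ih (List.nodup_cons.1 hcs).2 (fun u hu => hd u (by simp [hu])) (l := l)
      (by simpa using hl) (σ := σ + (π + 2 * c)) (by omega)
      (W := (W₁ ++ W₂).map F)
      (by
        intro w' hw'
        obtain ⟨w, hw, rfl⟩ := List.mem_map.1 hw'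
        rw [hF]
        exact eliminate_zero hcs (hz w (hsub w hw)))
      (by
        intro w' hw'
        obtain ⟨w, hw, rfl⟩ := List.mem_map.1 hw'
        rw [hF]
        exact eliminate_contains hcs hd₀ hcert (hW _ hpW) (hW w (hsub w hw)) (hz _ hpW))
      (by
        intro w' hw' u hu
        obtain ⟨w, hw, rfl⟩ := List.mem_map.1 hw'
        rw [hF, coeff_elimPoly]
        refine le_trans (le_min (hval w (hsub w hw) u hu) ?_) (v.map_sub _ _)
        rw [v.map_mul]
        exact coe_le_add (le_val_div hπ.symm (hπmin w (hsub w hw))) (hval _ hpW u hu) (by omega))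
      (by
        intro w' hw' u hu
        obtain ⟨w, hw, rfl⟩ := List.mem_map.1 hw'
        rw [hF]
        by_cases hucs : u ∈ cs
        · have huc : u ≠ c₀ := by
            rintro rfl
            exact (List.nodup_cons.1 hcs).1 hucs
          simp only [val_eliminate m hcs]
          rw [if_neg huc, if_pos hucs]
          have := le_ord_elimination (hW w (hsub w hw) _ hd₀) hpc (hW _ hpW u hu) hcert hπ.symm
            (hπmin w (hsub w hw)) (hval _ hpW u hu) (hord w (hsub w hw) _ hd₀)
            (hord _ hpW _ hd₀) (hord w (hsub w hw) u hu) (hord _ hpW u hu)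
            (m := m) (hπk.trans_lt hkm) (by omega) hc hcπ
          rwa [sub_sub] at this
        · simp only [eliminate_zero hcs (hz w (hsub w hw)) u hu hucs]
          exact le_top)
      (e := fun x => F (e (a₁.succAbove x))) (fun x => List.mem_map_of_mem (hmem x))
      (k := k') (by simp only [hF]; exact hk'.symm) (by linarith)
    refine ⟨by simpa using key.1, ?_⟩
    intro Q hQ u hu
    rw [List.take_succ_cons] at hQ
    rcases List.mem_cons.1 hQ with rfl | hQ
    · refine le_trans ?_ (hord _ hpW u hu)
      have : (m : ℤ) - P ≤ m - σ := by linarith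
      exact_mod_cast this
    · exact key.2 Q hQ u hu

end Precision

section Algebra

open MvPolynomial

variable {K : Type*} [Field K] {n s : ℕ} {w : MonomialOrder (Fin n)}

/-! ## Leading monomials of ideals -/

lemma LM_upward {I : Ideal (MvPolynomial (Fin n) K)} {α β : Mon n} (hα : α ∈ LM w I)
    (h : α ≤ β) : β ∈ LM w I := by
  classical
  obtain ⟨p, hp, h0, rfl⟩ := hα
  have hm : monomial (β - w.degree p) (1 : K) ≠ 0 := by simp
  refine ⟨monomial (β - w.degree p) 1 * p, I.mul_mem_left _ hp, mul_ne_zero hm h0, ?_⟩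
  rw [w.degree_mul hm h0, w.degree_monomial, if_neg one_ne_zero, tsub_add_cancel_of_le h]

/-- Division by all non-zero elements of `I` at once; the remainder then has no monomial in `LM w
I`. -/
lemma exists_normalForm (w : MonomialOrder (Fin n)) (I : Ideal (MvPolynomial (Fin n) K))
    (h : MvPolynomial (Fin n) K) :
    ∃ r, h - r ∈ I ∧ (∀ u ∈ r.support, u ∉ LM w I) ∧
      w.toSyn (w.degree r) ≤ w.toSyn (w.degree h) := by
  obtain ⟨g, r, hh, hg, hr⟩ := w.div_set (B := {b | b ∈ I ∧ b ≠ 0})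
    (fun b hb => (w.leadingCoeff_ne_zero_iff.2 hb.2).isUnit) h
  have hsum : h - r = g.sum fun b a => a * (b : MvPolynomial (Fin n) K) := by
    rw [hh, add_sub_cancel_right, Finsupp.linearCombination_apply]
    simp
  refine ⟨r, ?_, ?_, ?_⟩
  · rw [hsum]
    exact I.sum_mem fun b _ => I.mul_mem_left _ b.2.1
  · rintro u hu ⟨p, hp, h0, rfl⟩
    exact hr _ hu p ⟨hp, h0⟩ le_rfl
  · have h1 : r = h - g.sum fun b a => a * (b : MvPolynomial (Fin n) K) := by
      rw [← hsum, sub_sub_cancel]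
    rw [h1]
    refine w.degree_sub_le.trans (sup_le le_rfl ?_)
    refine w.degree_sum_le.trans (Finset.sup_le fun b _ => ?_)
    change w.toSyn (w.degree (g b * _)) ≤ _
    rw [mul_comm]
    exact hg b

lemma LM_mem_of_isHomogeneous {I : Ideal (MvPolynomial (Fin n) K)}
    (hI : ∀ p ∈ I, ∀ d, homogeneousComponent d p ∈ I) {α : Mon n} (hα : α ∈ LM w I) :
    ∃ p ∈ I, p ≠ 0 ∧ p.IsHomogeneous α.degree ∧ w.degree p = α := by
  obtain ⟨p, hp, h0, rfl⟩ := hα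
  have hc : (homogeneousComponent (w.degree p).degree p).coeff (w.degree p) ≠ 0 := by
    rw [coeff_homogeneousComponent, if_pos rfl]
    exact w.coeff_degree_ne_zero_iff.2 h0
  refine ⟨homogeneousComponent (w.degree p).degree p, hI p hp _,
    fun h => hc (by rw [h, coeff_zero]), homogeneousComponent_isHomogeneous _ _, ?_⟩
  apply w.toSyn.injective
  refine le_antisymm ?_ (w.le_degree (mem_support_iff.2 hc))
  refine w.degree_le_iff.2 fun u hu => w.le_degree ?_
  rw [support_homogeneousComponent] at hu
  exact (Finset.mem_filter.1 hu).1

lemma degree_eq_of_isHomogeneous {p : MvPolynomial (Fin n) K} {d : ℕ} (hp : p.IsHomogeneous d)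
    (h0 : p ≠ 0) : (w.degree p).degree = d := by
  by_contra h
  exact w.coeff_degree_ne_zero_iff.2 h0 (hp.coeff_eq_zero h)

/-- The leading monomials of a spanned space are at most as many as the generators. -/
lemma card_le_of_span (S : Finset (Mon n)) {ι : Type*} [Fintype ι] (g : ι → MvPolynomial (Fin n) K)
    (hS : ∀ α ∈ S, ∃ p ∈ Submodule.span K (Set.range g), p ≠ 0 ∧ w.degree p = α) :
    S.card ≤ Fintype.card ι := by
  classical
  choose! p hp h0 hdeg using hS
  have hli : LinearIndependent K fun α : S =>
      (⟨p α, hp α α.2⟩ : Submodule.span K (Set.range g)) := by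
    rw [linearIndependent_iff']
    intro t c hc
    by_contra! hne
    obtain ⟨α₀, hα₀, hc₀⟩ := hne
    -- At the greatest monomial occurring in the relation, only its own polynomial has a non-zero
    -- coefficient.
    obtain ⟨α, hα, hmax⟩ := (t.filter fun α => c α ≠ 0).exists_max_image
      (fun α => w.toSyn (α : Mon n)) ⟨α₀, by simp [hα₀, hc₀]⟩
    rw [Finset.mem_filter] at hα
    have h1 := congrArg (fun x : Submodule.span K (Set.range g) =>
      (x : MvPolynomial (Fin n) K).coeff α) hc
    simp only [AddSubmonoidClass.coe_finsetSum, SetLike.val_smul, coeff_sum, coeff_smul,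
      ZeroMemClass.coe_zero, coeff_zero] at h1
    rw [Finset.sum_eq_single_of_mem α hα.1] at h1
    · have h2 : (p α).coeff α ≠ 0 := by
        conv => enter [1, 1]; rw [← hdeg α α.2]
        exact w.coeff_degree_ne_zero_iff.2 (h0 α α.2)
      exact (mul_ne_zero hα.2 h2) h1
    · intro β hβ hne
      by_cases hcβ : c β = 0
      · simp [hcβ]
      · have hlt : w.toSyn (β : Mon n) < w.toSyn α :=
          lt_of_le_of_ne (hmax β (by simp [hβ, hcβ]))
            fun h => hne (Subtype.ext (w.toSyn.injective h))
        rw [w.coeff_eq_zero_of_lt (by rwa [hdeg β β.2]), smul_zero]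
  have : Module.Finite K (Submodule.span K (Set.range g)) :=
    FiniteDimensional.span_of_finite K (Set.finite_range g)
  calc S.card = Fintype.card S := by simp
    _ ≤ Module.finrank K (Submodule.span K (Set.range g)) := hli.fintype_card_le_finrank
    _ ≤ Fintype.card ι := finrank_range_le_card g

/-- Linearly independent elements of a space are at most as many as its leading monomials. -/
lemma card_le_of_linearIndependent (S : Finset (Mon n)) {ι : Type*} [Fintype ι]
    {g : ι → MvPolynomial (Fin n) K} (hg : LinearIndependent K g)
    (hS : ∀ p ∈ Submodule.span K (Set.range g), p ≠ 0 → w.degree p ∈ S) :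
    Fintype.card ι ≤ S.card := by
  -- Coefficients at `S` detect the non-zero elements of the span, through their leading monomials;
  -- so `φ` is injective there.
  let φ : MvPolynomial (Fin n) K →ₗ[K] (S → K) := LinearMap.pi fun α => lcoeff K (α : Mon n)
  have hφ : LinearIndependent K (φ ∘ g) := by
    refine hg.map ?_
    rw [Submodule.disjoint_def]
    intro p hp hker
    by_contra h0
    have := congrFun (LinearMap.mem_ker.1 hker) ⟨_, hS p hp h0⟩
    exact w.coeff_degree_ne_zero_iff.2 h0 this
  simpa using hφ.fintype_card_le_finrank

/-! ## The reduced Gröbner basis -/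

/-- The monomial `x ^ α` minus its normal form. -/
lemma exists_reduced {I : Ideal (MvPolynomial (Fin n) K)} {α : Mon n} (hα : α ∈ LM w I) :
    ∃ g ∈ I, w.degree g = α ∧ w.leadingCoeff g = 1 ∧
      ∀ u ∈ g.support, u = α ∨ u ∉ LM w I := by
  classical
  obtain ⟨r, hr, hsupp, hdeg⟩ := exists_normalForm w I (monomial α (1 : K))
  rw [w.degree_monomial, if_neg one_ne_zero] at hdeg
  have hrα : r.coeff α = 0 := by
    by_contra h
    exact hsupp α (mem_support_iff.2 h) hα
  have hco : (monomial α (1 : K) - r).coeff α = 1 := by simp [hrα]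
  have hd : w.degree (monomial α (1 : K) - r) = α := by
    apply w.toSyn.injective
    refine le_antisymm ?_ (w.le_degree (mem_support_iff.2 (by rw [hco]; exact one_ne_zero)))
    refine w.degree_sub_le.trans (sup_le ?_ hdeg)
    rw [w.degree_monomial, if_neg one_ne_zero]
  refine ⟨monomial α 1 - r, hr, hd, ?_, ?_⟩
  · rw [MonomialOrder.leadingCoeff, hd, hco]
  · intro u hu
    by_cases h : u = α
    · exact Or.inl h
    · refine Or.inr (hsupp u ?_)
      rw [mem_support_iff] at hu ⊢
      intro h0
      apply hu
      rw [coeff_sub, coeff_monomial, if_neg (Ne.symm h), h0, sub_zero]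

/-- Take `x ^ α` minus its normal form for each minimal `α`. `IsWeaklyIdeal` quantifies over all
reduced bases, so it says something only once one is exhibited. -/
lemma exists_isReducedGB (w : MonomialOrder (Fin n)) (I : Ideal (MvPolynomial (Fin n) K)) :
    ∃ G, IsReducedGB w I G ∧ ∀ α, Minimal (· ∈ LM w I) α → ∃ g ∈ G, w.degree g = α := by
  choose! g hgI hdeg hlc hsupp using
    fun α (hα : α ∈ LM w I) => exists_reduced hα
  refine ⟨g '' {α | Minimal (· ∈ LM w I) α}, ⟨?_, ?_, ?_, ?_⟩, ?_⟩
  · rintro _ ⟨α, hα, rfl⟩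
    exact hgI α hα.prop
  · intro p hp h0
    obtain ⟨α, hle, hα⟩ := exists_minimal_le_of_wellFoundedLT (· ∈ LM w I) (w.degree p)
      ⟨p, hp, h0, rfl⟩
    exact ⟨g α, ⟨α, hα, rfl⟩, by rwa [hdeg α hα.prop]⟩
  · rintro _ ⟨α, hα, rfl⟩
    exact hlc α hα.prop
  · rintro _ ⟨α, hα, rfl⟩ _ ⟨β, hβ, rfl⟩ hne u hu hle
    rw [hdeg β hβ.prop] at hle
    rcases hsupp α hα.prop u hu with rfl | hnot
    · exact hne (by rw [le_antisymm hle (hα.le_of_le hβ.prop hle)])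
    · exact hnot (LM_upward hβ.prop hle)
  · intro α hα
    exact ⟨g α, ⟨α, hα, rfl⟩, hdeg α hα.prop⟩

/-- Since `LM w I` is closed under multiples, testing the quotients by single variables suffices for
`u` to be minimal, hence a leading monomial of the reduced basis. -/
lemma IsWeaklyIdeal.mem_LM {I : Ideal (MvPolynomial (Fin n) K)} (hI : IsWeaklyIdeal w I)
    {u β : Mon n} (hu : u ∈ LM w I)
    (hmin : ∀ k, Finsupp.single k 1 ≤ u → u - Finsupp.single k 1 ∉ LM w I)
    (hβ : β.degree = u.degree) (hlt : w.toSyn u < w.toSyn β) : β ∈ LM w I := by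
  obtain ⟨G, hG, hGmin⟩ := exists_isReducedGB w I
  have hmin' : Minimal (· ∈ LM w I) u := by
    refine ⟨hu, fun u' hu' hle => ?_⟩
    by_contra hnle
    obtain ⟨k, hk⟩ : ∃ k, u' k < u k := by
      by_contra! h
      exact hnle h
    have hs : Finsupp.single k 1 ≤ u := by
      rw [Finsupp.single_le_iff]
      omega
    refine hmin k hs (LM_upward hu' fun j => ?_)
    have := hle j
    by_cases hj : k = j
    · subst hj
      simp
      omega
    · simpa [Finsupp.single_apply, hj] using this
  obtain ⟨g, hg, rfl⟩ := hGmin u hmin'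
  exact hI G hG g hg β hβ hlt

/-! ## Monomials of a given degree -/

lemma mem_monomials {d : ℕ} {u : Mon n} : u ∈ monomials w d ↔ u.degree = d := by
  simp only [monomials, List.mem_map, Finset.mem_sort, Finset.mem_map, Finset.mem_finsuppAntidiag]
  constructor
  · rintro ⟨a, ⟨b, ⟨hb, -⟩, rfl⟩, rfl⟩
    simpa [Finsupp.degree_eq_sum] using hb
  · intro h
    exact ⟨w.toSyn u, ⟨u, ⟨by simpa [Finsupp.degree_eq_sum] using h, by simp⟩, rfl⟩, by simp⟩

lemma monomials_pairwise (w : MonomialOrder (Fin n)) (d : ℕ) :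
    (monomials w d).Pairwise fun a b => w.toSyn b < w.toSyn a := by
  rw [monomials, List.pairwise_map]
  have h1 := Finset.pairwise_sort ((Finset.finsuppAntidiag (Finset.univ : Finset (Fin n)) d).map
    w.toSyn.toEquiv.toEmbedding) (fun a b => b ≤ a)
  have h2 := Finset.sort_nodup ((Finset.finsuppAntidiag (Finset.univ : Finset (Fin n)) d).map
    w.toSyn.toEquiv.toEmbedding) (fun a b => b ≤ a)
  refine (h1.and h2).imp fun {a b} hab => ?_
  simpa using lt_of_le_of_ne hab.1 (Ne.symm hab.2)

lemma monomials_nodup (w : MonomialOrder (Fin n)) (d : ℕ) : (monomials w d).Nodup :=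
  (monomials_pairwise w d).imp fun h => by
    rintro rfl
    exact lt_irrefl _ h

lemma length_monomials (w : MonomialOrder (Fin n)) (d : ℕ) :
    (monomials w d).length = (n + d - 1).choose d := by
  simp [monomials, Finset.card_finsuppAntidiag_nat_eq_choose]

open Classical in
/-- The leading monomials of degree `d` of an ideal. -/
noncomputable def LMdeg (w : MonomialOrder (Fin n)) (I : Ideal (MvPolynomial (Fin n) K)) (d : ℕ) :
    Finset (Mon n) :=
  (monomials w d).toFinset.filter (· ∈ LM w I)

lemma mem_LMdeg {I : Ideal (MvPolynomial (Fin n) K)} {d : ℕ} {u : Mon n} :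
    u ∈ LMdeg w I d ↔ u.degree = d ∧ u ∈ LM w I := by
  classical
  simp [LMdeg, mem_monomials]

lemma card_LMdeg_le (w : MonomialOrder (Fin n)) (I : Ideal (MvPolynomial (Fin n) K)) (d : ℕ) :
    (LMdeg w I d).card ≤ (monomials w d).length := by
  classical
  exact (Finset.card_filter_le _ _).trans (List.toFinset_card_le _)

end Algebra

section F5

open MvPolynomial

variable {K : Type*} [Field K] {n s : ℕ} {w : MonomialOrder (Fin n)}
  {f : Fin s → MvPolynomial (Fin n) K} {deg : Fin s → ℕ}

/-! ## The F5 criterion -/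

/-- The ideal of the first `k` polynomials. -/
noncomputable def prefixIdeal (f : Fin s → MvPolynomial (Fin n) K) (k : ℕ) : Ideal (MvPolynomial (Fin n) K) :=
  Ideal.span (f '' {j | (j : ℕ) < k})

lemma prefixIdeal_mono {k k' : ℕ} (h : k ≤ k') : prefixIdeal f k ≤ prefixIdeal f k' :=
  Ideal.span_mono (Set.image_mono fun _ hj => lt_of_lt_of_le hj h)

lemma mem_prefixIdeal {j : Fin s} {k : ℕ} (h : (j : ℕ) < k) : f j ∈ prefixIdeal f k :=
  Ideal.subset_span ⟨j, h, rfl⟩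

lemma prefixIdeal_zero : prefixIdeal f 0 = ⊥ := by
  simp [prefixIdeal]

lemma prefixIdeal_eq_Iic (i : Fin s) : prefixIdeal f (i + 1) = Ideal.span (f '' Set.Iic i) := by
  have h : {j : Fin s | (j : ℕ) < i + 1} = Set.Iic i := by
    ext j
    exact Nat.lt_succ_iff
  rw [prefixIdeal, h]

lemma prefixIdeal_self : prefixIdeal f s = Ideal.span (Set.range f) := by
  have h : {j : Fin s | (j : ℕ) < s} = Set.univ := Set.eq_univ_of_forall fun j => j.2
  rw [prefixIdeal, h, Set.image_univ]

lemma homogeneousComponent_mem_prefixIdeal (hf : ∀ i, (f i).IsHomogeneous (deg i)) (k : ℕ) :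
    ∀ p ∈ prefixIdeal f k, ∀ d, homogeneousComponent d p ∈ prefixIdeal f k := by
  intro p hp d
  let : GradedAlgebra (homogeneousSubmodule (Fin n) K) := gradedAlgebra
  refine homogeneousComponent_mem_of_mem ?_ hp d
  refine Ideal.homogeneous_span _ _ ?_
  rintro _ ⟨j, -, rfl⟩
  exact ⟨deg j, hf j⟩

lemma exists_mul_add_of_mem_prefixIdeal {k : ℕ} (hk : k < s) {p : MvPolynomial (Fin n) K}
    (hp : p ∈ prefixIdeal f (k + 1)) :
    ∃ a, ∃ z ∈ prefixIdeal f k, p = a * f ⟨k, hk⟩ + z := by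
  have h : {j : Fin s | (j : ℕ) < k + 1} = insert ⟨k, hk⟩ {j : Fin s | (j : ℕ) < k} := by
    ext j
    simp [Fin.ext_iff]
    omega
  rw [prefixIdeal, h, Set.image_insert_eq] at hp
  exact Ideal.mem_span_insert.1 hp

/-- The polynomial of a row of a Macaulay matrix. -/
noncomputable def rowPoly (f : Fin s → MvPolynomial (Fin n) K) (r : Fin s × Mon n) :
    MvPolynomial (Fin n) K :=
  monomial r.2 1 * f r.1

lemma rowPoly_isHomogeneous (hf : ∀ i, (f i).IsHomogeneous (deg i)) (r : Fin s × Mon n) :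
    (rowPoly f r).IsHomogeneous (r.2.degree + deg r.1) :=
  (isHomogeneous_monomial 1 rfl).mul (hf r.1)

lemma rowPoly_mem {k : ℕ} {r : Fin s × Mon n} (h : (r.1 : ℕ) < k) :
    rowPoly f r ∈ prefixIdeal f k :=
  Ideal.mul_mem_left _ _ (mem_prefixIdeal h)

lemma mul_eq_sum_rowPoly (a : MvPolynomial (Fin n) K) (i : Fin s) :
    a * f i = ∑ u ∈ a.support, a.coeff u • rowPoly f (i, u) := by
  conv_lhs => rw [a.as_sum, Finset.sum_mul]
  refine Finset.sum_congr rfl fun u _ => ?_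
  rw [rowPoly, ← smul_mul_assoc, smul_monomial, smul_eq_mul, mul_one]

/-- Rows excluded by the F5 criterion are redundant. -/
lemma mem_span_rowPoly (hf : ∀ i, (f i).IsHomogeneous (deg i)) (w : MonomialOrder (Fin n)) {d : ℕ}
    {R : Set (Fin s × Mon n)} {k : ℕ} (hk : k ≤ s)
    (hR : ∀ r : Fin s × Mon n, (r.1 : ℕ) < k → r.2.degree + deg r.1 = d →
      r.2 ∉ LM w (prefixIdeal f r.1) → r ∈ R)
    {p : MvPolynomial (Fin n) K} (hp : p ∈ prefixIdeal f k) (hpd : p.IsHomogeneous d) :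
    p ∈ Submodule.span K (rowPoly f '' R) := by
  induction k generalizing p with
  | zero =>
    rw [prefixIdeal_zero, Ideal.mem_bot] at hp
    rw [hp]
    exact Submodule.zero_mem _
  | succ k ih =>
    obtain ⟨a, z, hz, rfl⟩ := exists_mul_add_of_mem_prefixIdeal hk hp
    -- Replace the multiplier of the last polynomial by its normal form modulo the previous ideal.
    -- The difference contributes an element of that ideal, left to the induction; the monomials of
    -- the normal form pass the F5 criterion.
    obtain ⟨r, hr, hsupp, -⟩ := exists_normalForm w (prefixIdeal f k) a
    have h1 : a * f ⟨k, hk⟩ + z = r * f ⟨k, hk⟩ + ((a - r) * f ⟨k, hk⟩ + z) := by ring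
    have hz' : (a - r) * f ⟨k, hk⟩ + z ∈ prefixIdeal f k :=
      Ideal.add_mem _ (Ideal.mul_mem_right _ _ hr) hz
    rw [← homogeneousComponent_eq_self hpd, h1, map_add]
    refine Submodule.add_mem _ ?_ (ih (by omega) (fun r hr => hR r (by omega))
      (homogeneousComponent_mem_prefixIdeal hf k _ hz' d)
      (homogeneousComponent_isHomogeneous _ _))
    rw [mul_eq_sum_rowPoly, map_sum]
    refine Submodule.sum_mem _ fun u hu => ?_
    rw [map_smul, homogeneousComponent_of_mem (rowPoly_isHomogeneous hf _)]
    split_ifs with hd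
    · exact Submodule.smul_mem _ _ (Submodule.subset_span
        ⟨_, hR (⟨k, hk⟩, u) (by simp) hd.symm (hsupp u hu), rfl⟩)
    · rw [smul_zero]
      exact Submodule.zero_mem _

lemma mem_prefixIdeal_of_isRegular
    (hreg : RingTheory.Sequence.IsRegular (MvPolynomial (Fin n) K) (List.ofFn f)) (i : Fin s)
    {h : MvPolynomial (Fin n) K} (hmem : h * f i ∈ prefixIdeal f i) : h ∈ prefixIdeal f i := by
  have hideal : Ideal.ofList ((List.ofFn f).take i) • (⊤ : Ideal (MvPolynomial (Fin n) K)) =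
      prefixIdeal f i := by
    rw [smul_eq_mul, Ideal.mul_top, Ideal.ofList, prefixIdeal]
    congr 1
    ext x
    simp only [Set.mem_ofPred_eq, Set.mem_image, List.mem_take_iff_getElem, List.getElem_ofFn,
      List.length_ofFn]
    constructor
    · rintro ⟨j, hj, rfl⟩
      exact ⟨⟨j, by omega⟩, by simp; omega, rfl⟩
    · rintro ⟨j, hj, rfl⟩
      exact ⟨j, by have := j.2; omega, rfl⟩
  have h1 := hreg.regular_mod_prev i (by simp)
  rw [hideal] at h1
  rw [isSMulRegular_iff_right_eq_zero_of_smul] at h1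
  have h2 := h1 (Submodule.Quotient.mk h) (by
    rw [← Submodule.Quotient.mk_smul, Submodule.Quotient.mk_eq_zero]
    simpa [mul_comm] using hmem)
  exact (Submodule.Quotient.mk_eq_zero _).1 h2

lemma prefixIdeal_ne_top
    (hreg : RingTheory.Sequence.IsRegular (MvPolynomial (Fin n) K) (List.ofFn f)) :
    prefixIdeal f s ≠ ⊤ := by
  intro h
  apply hreg.top_ne_smul
  rw [smul_eq_mul, Ideal.mul_top, Ideal.ofList, ← h, prefixIdeal_self]
  congr 1
  ext x
  simp

lemma ne_zero_of_isRegular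
    (hreg : RingTheory.Sequence.IsRegular (MvPolynomial (Fin n) K) (List.ofFn f)) (i : Fin s) :
    f i ≠ 0 := by
  intro h0
  apply prefixIdeal_ne_top hreg
  rw [Ideal.eq_top_iff_one]
  exact prefixIdeal_mono i.2.le (mem_prefixIdeal_of_isRegular hreg i
    (by rw [h0, mul_zero]; exact Ideal.zero_mem _))

/-- A non-zero constant would generate the unit ideal. Positivity ensures that the F5 criterion in
degree `d` consults only matrices of smaller degree. -/
lemma deg_pos_of_isRegular (hf : ∀ i, (f i).IsHomogeneous (deg i))
    (hreg : RingTheory.Sequence.IsRegular (MvPolynomial (Fin n) K) (List.ofFn f)) (i : Fin s) :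
    0 < deg i := by
  rw [Nat.pos_iff_ne_zero]
  intro h0
  have hi := hf i
  rw [h0] at hi
  have hC : f i = C ((f i).coeff 0) := totalDegree_eq_zero_iff_eq_C.1
    (Nat.le_zero.1 hi.totalDegree_le)
  apply prefixIdeal_ne_top hreg
  rw [Ideal.eq_top_iff_one]
  have hc : (f i).coeff 0 ≠ 0 := by
    intro hc
    rw [hc, C_0] at hC
    exact ne_zero_of_isRegular hreg i hC
  have h1 := Ideal.mul_mem_left _ (C ((f i).coeff 0)⁻¹) (mem_prefixIdeal (f := f) i.2)
  rw [hC, ← C_mul] at h1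
  simpa [hc] using h1

lemma pos_of_isRegular (hf : ∀ i, (f i).IsHomogeneous (deg i))
    (hreg : RingTheory.Sequence.IsRegular (MvPolynomial (Fin n) K) (List.ofFn f)) (i : Fin s) :
    0 < n := by
  rw [Nat.pos_iff_ne_zero]
  rintro rfl
  refine ne_zero_of_isRegular hreg i ?_
  ext u
  rw [coeff_zero]
  refine (hf i).coeff_eq_zero ?_
  rw [Subsingleton.elim u 0, map_zero]
  exact (deg_pos_of_isRegular hf hreg i).ne

/-- For the last `i` with `h i ≠ 0`, the product `h i * f i` lies in the previous ideal, hence so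
does `h i` by regularity. Its leading monomial then contradicts `hsupp`. -/
lemma eq_zero_of_sum_mul_eq_zero
    (hreg : RingTheory.Sequence.IsRegular (MvPolynomial (Fin n) K) (List.ofFn f))
    {h : Fin s → MvPolynomial (Fin n) K}
    (hsupp : ∀ j, ∀ u ∈ (h j).support, u ∉ LM w (prefixIdeal f j))
    (hsum : ∑ j, h j * f j = 0) (j : Fin s) : h j = 0 := by
  classical
  by_contra hj
  obtain ⟨i, hi, hmax⟩ := (Finset.univ.filter fun j => h j ≠ 0).exists_max_image id
    ⟨j, by simp [hj]⟩
  rw [Finset.mem_filter] at hi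
  have hmem : h i * f i ∈ prefixIdeal f i := by
    rw [← Finset.add_sum_erase _ _ (Finset.mem_univ i), add_eq_zero_iff_eq_neg] at hsum
    rw [hsum]
    refine Ideal.neg_mem_iff _ |>.2 (Ideal.sum_mem _ fun k hk => ?_)
    by_cases hk0 : h k = 0
    · rw [hk0, zero_mul]
      exact Ideal.zero_mem _
    · refine Ideal.mul_mem_left _ _ (mem_prefixIdeal ?_)
      exact lt_of_le_of_ne (hmax k (by simp [hk0])) (fun h => Finset.ne_of_mem_erase hk (Fin.ext h))
  exact hsupp i _ (w.degree_mem_support hi.2)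
    ⟨h i, mem_prefixIdeal_of_isRegular hreg i hmem, hi.2, rfl⟩

/-- The rows kept by the F5 criterion. -/
def IsF5Row (w : MonomialOrder (Fin n)) (f : Fin s → MvPolynomial (Fin n) K) (deg : Fin s → ℕ)
    (d k : ℕ) (r : Fin s × Mon n) : Prop :=
  (r.1 : ℕ) < k ∧ r.2.degree + deg r.1 = d ∧ r.2 ∉ LM w (prefixIdeal f r.1)

lemma linearIndepOn_rowPoly
    (hreg : RingTheory.Sequence.IsRegular (MvPolynomial (Fin n) K) (List.ofFn f)) (d k : ℕ) :
    LinearIndepOn K (rowPoly f) {r | IsF5Row w f deg d k r} := by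
  classical
  rw [linearIndepOn_iff]
  intro l hl hsum
  rw [Finsupp.linearCombination_apply, Finsupp.sum] at hsum
  -- Collect the terms of the relation polynomial by polynomial, to get a syzygy of `f`.
  let h : Fin s → MvPolynomial (Fin n) K := fun j =>
    ∑ r ∈ l.support, if r.1 = j then monomial r.2 (l r) else 0
  have hcoeff : ∀ j u, (h j).coeff u = l (j, u) := by
    intro j u
    simp only [h, coeff_sum]
    rw [Finset.sum_eq_single (j, u)]
    · simp
    · rintro ⟨j', u'⟩ - hne
      split_ifs with hj
      · rw [coeff_monomial, if_neg]
        rintro rfl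
        exact hne (by rw [← hj])
      · simp
    · intro hnot
      simpa using hnot
  have hzero := eq_zero_of_sum_mul_eq_zero (w := w) hreg (h := h) (by
      intro j u hu
      rw [mem_support_iff, hcoeff] at hu
      exact (hl (Finsupp.mem_support_iff.2 hu)).2.2)
    (by
      rw [← hsum]
      simp only [h, Finset.sum_mul]
      rw [Finset.sum_comm]
      refine Finset.sum_congr rfl fun r _ => ?_
      simp only [ite_mul, zero_mul, Finset.sum_ite_eq, Finset.mem_univ, if_true]
      rw [rowPoly, ← smul_mul_assoc, smul_monomial, smul_eq_mul, mul_one])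
  ext ⟨j, u⟩
  rw [← hcoeff, hzero, coeff_zero, Finsupp.zero_apply]

/-- Number of rows kept by the F5 criterion. -/
lemma length_eq_card_LMdeg (hf : ∀ i, (f i).IsHomogeneous (deg i))
    (hreg : RingTheory.Sequence.IsRegular (MvPolynomial (Fin n) K) (List.ofFn f)) {d k : ℕ}
    (hk : k ≤ s) {R : List (Fin s × Mon n)} (hR : R.Nodup)
    (hmem : ∀ r, r ∈ R ↔ IsF5Row w f deg d k r) :
    R.length = (LMdeg w (prefixIdeal f k) d).card := by
  have hset : {r | IsF5Row w f deg d k r} = Set.range R.get := by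
    ext r
    rw [Set.mem_ofPred_eq, ← hmem, List.mem_iff_get]
    rfl
  have hrange : Set.range (rowPoly f ∘ R.get) = rowPoly f '' {r | IsF5Row w f deg d k r} := by
    rw [hset, Set.range_comp]
  apply le_antisymm
  · have hli : LinearIndependent K (rowPoly f ∘ R.get) := by
      have h1 := linearIndepOn_rowPoly (w := w) (deg := deg) hreg d k
      rw [hset] at h1
      exact (linearIndepOn_range_iff (List.nodup_iff_injective_get.1 hR) _).1 h1
    have := card_le_of_linearIndependent (w := w) (LMdeg w (prefixIdeal f k) d) hli ?_
    · simpa using this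
    · intro p hp h0
      have hV : Submodule.span K (Set.range (rowPoly f ∘ R.get)) ≤
          (prefixIdeal f k).restrictScalars K ⊓ homogeneousSubmodule (Fin n) K d := by
        rw [hrange, Submodule.span_le]
        rintro _ ⟨r, hr, rfl⟩
        exact ⟨rowPoly_mem hr.1, hr.2.1 ▸ rowPoly_isHomogeneous hf r⟩
      have hp' := hV hp
      exact mem_LMdeg.2 ⟨degree_eq_of_isHomogeneous hp'.2 h0, p, hp'.1, h0, rfl⟩
  · have := card_le_of_span (w := w) (LMdeg w (prefixIdeal f k) d) (rowPoly f ∘ R.get) ?_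
    · simpa using this
    · intro α hα
      obtain ⟨rfl, hα'⟩ := mem_LMdeg.1 hα
      obtain ⟨p, hp, h0, hh, hdeg⟩ :=
        LM_mem_of_isHomogeneous (homogeneousComponent_mem_prefixIdeal hf k) hα'
      refine ⟨p, ?_, h0, hdeg⟩
      rw [hrange]
      exact mem_span_rowPoly hf w hk (R := {r | IsF5Row w f deg α.degree k r})
        (fun r h1 h2 h3 => ⟨h1, h2, h3⟩) hp hh

lemma finite_isF5Row (w : MonomialOrder (Fin n)) (f : Fin s → MvPolynomial (Fin n) K)
    (deg : Fin s → ℕ) (d k : ℕ) : {r | IsF5Row w f deg d k r}.Finite := by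
  have : {r | IsF5Row w f deg d k r} ⊆
      ⋃ j : Fin s, Prod.mk j '' {u | u ∈ monomials w (d - deg j)} := by
    rintro ⟨j, u⟩ ⟨-, h2, -⟩
    simp only [Set.mem_iUnion]
    exact ⟨j, u, mem_monomials.2 (by simp only at h2; omega), rfl⟩
  refine Set.Finite.subset (Set.finite_iUnion fun j => Set.Finite.image _ ?_) this
  exact List.finite_toSet _

/-- If the leading monomials of small degree are also leading monomials of the ideals of a second
sequence, there are no others. -/
lemma LM_le_of_LM_ge (hf : ∀ i, (f i).IsHomogeneous (deg i))
    (hreg : RingTheory.Sequence.IsRegular (MvPolynomial (Fin n) K) (List.ofFn f))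
    {f' : Fin s → MvPolynomial (Fin n) K} (hf' : ∀ i, (f' i).IsHomogeneous (deg i)) {D : ℕ}
    (h : ∀ k ≤ s, ∀ u ∈ LM w (prefixIdeal f k), u.degree ≤ D → u ∈ LM w (prefixIdeal f' k))
    {k : ℕ} (hk : k ≤ s) {u : Mon n} (hu : u ∈ LM w (prefixIdeal f' k)) (hD : u.degree ≤ D) :
    u ∈ LM w (prefixIdeal f k) := by
  set d := u.degree with hd
  have hfin := finite_isF5Row w f deg d k
  set R := hfin.toFinset.toList with hR
  have hmem : ∀ r, r ∈ R ↔ IsF5Row w f deg d k r := by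
    intro r
    simp [hR]
  have hlen := length_eq_card_LMdeg hf hreg hk (Finset.nodup_toList _) hmem
  have hsub : LMdeg w (prefixIdeal f k) d ⊆ LMdeg w (prefixIdeal f' k) d := by
    intro α hα
    rw [mem_LMdeg] at hα ⊢
    exact ⟨hα.1, h k hk α hα.2 (hα.1.le.trans hD)⟩
  -- The rows kept for `f` include those kept for `f'`, because the ideals of `f'` have more leading
  -- monomials; so they still span when formed with `f'`. Their number is the number of leading
  -- monomials for `f`.
  have hcard := card_le_of_span (w := w) (LMdeg w (prefixIdeal f' k) d) (rowPoly f' ∘ R.get) (by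
    intro α hα
    obtain ⟨hαd, hα⟩ := mem_LMdeg.1 hα
    obtain ⟨p, hp, h0, hh, hdeg⟩ :=
      LM_mem_of_isHomogeneous (homogeneousComponent_mem_prefixIdeal hf' k) hα
    rw [hαd] at hh
    refine ⟨p, ?_, h0, hdeg⟩
    rw [Set.range_comp]
    refine mem_span_rowPoly hf' w hk (fun r h1 h2 h3 => ?_) hp hh
    obtain ⟨i, hi⟩ := List.mem_iff_get.1 ((hmem r).2 ⟨h1, h2, fun h4 => h3 (h _ (by omega) _ h4
      (by omega))⟩)
    exact ⟨i, hi⟩)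
  rw [Fintype.card_fin, hlen] at hcard
  have heq := Finset.eq_of_subset_of_card_le hsub hcard
  have : u ∈ LMdeg w (prefixIdeal f' k) d := mem_LMdeg.2 ⟨hd.symm, hu⟩
  rw [← heq] at this
  exact (mem_LMdeg.1 this).2

end F5

section FreeColumns

open MvPolynomial

variable {K : Type*} [Field K] {n s : ℕ} {w : MonomialOrder (Fin n)}
  {f : Fin s → MvPolynomial (Fin n) K} {deg : Fin s → ℕ}

/-! ## The number of free columns -/

lemma getD_monomials_mem {d b : ℕ} (hb : b < (monomials w d).length) :
    (monomials w d).getD b 0 ∈ monomials w d := by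
  rw [List.getD_eq_getElem _ _ hb]
  exact List.getElem_mem hb

lemma toSyn_getD_monomials_lt {d a b : ℕ} (hab : a < b) (hb : b < (monomials w d).length) :
    w.toSyn ((monomials w d).getD b 0) < w.toSyn ((monomials w d).getD a 0) := by
  rw [List.getD_eq_getElem _ _ hb, List.getD_eq_getElem _ _ (hab.trans hb)]
  exact List.pairwise_iff_getElem.1 (monomials_pairwise w d) a b _ _ hab

lemma freeColumns_le (w : MonomialOrder (Fin n)) (f : Fin s → MvPolynomial (Fin n) K)
    (deg : Fin s → ℕ) (d : ℕ) (i : Fin s) :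
    freeColumns w f deg d i ≤ (monomials w d).length := by
  classical
  exact Nat.findGreatest_le _

/-- A relation between columns is a linear form `φ` vanishing on the degree-`d` part of the ideal.
Evaluate it on an element whose leading monomial is the last column used: earlier columns contribute
zero by the choice of the element, later ones by that of the column. -/
lemma le_freeColumns (hf : ∀ i, (f i).IsHomogeneous (deg i)) {d k : ℕ} {i : Fin s}
    (hk : k ≤ (monomials w d).length)
    (h : ∀ b < k, (monomials w d).getD b 0 ∈ LM w (prefixIdeal f (i + 1))) :
    k ≤ freeColumns w f deg d i := by
  classical
  refine Nat.le_findGreatest hk ?_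
  rw [Fintype.linearIndependent_iff]
  intro c hc
  by_contra! hne
  obtain ⟨b₀, hb₀⟩ := hne
  obtain ⟨b, hb, hmax⟩ := (Finset.univ.filter fun b => c b ≠ 0).exists_max_image id
    ⟨b₀, by simp [hb₀]⟩
  rw [Finset.mem_filter] at hb
  let φ : MvPolynomial (Fin n) K →ₗ[K] K :=
    ∑ b : Fin k, c b • lcoeff K ((monomials w d).getD b 0)
  have hφ : ∀ p, φ p = ∑ b : Fin k, c b * p.coeff ((monomials w d).getD b 0) := by
    intro p
    simp [φ]
  have hspan : Submodule.span K (rowPoly f '' {r | IsF5Row w f deg d (i + 1) r}) ≤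
      LinearMap.ker φ := by
    rw [Submodule.span_le]
    rintro _ ⟨r, hr, rfl⟩
    let r' : F5Row w f deg d i := ⟨r, Fin.le_def.2 (Nat.lt_succ_iff.1 hr.1), hr.2.1, hr.2.2⟩
    have := congrFun hc r'
    rw [Finset.sum_apply] at this
    rw [SetLike.mem_coe, LinearMap.mem_ker, hφ]
    exact this
  have hbl : (b : ℕ) < (monomials w d).length := b.2.trans_le hk
  obtain ⟨p, hp, h0, hh, hdeg⟩ :=
    LM_mem_of_isHomogeneous (homogeneousComponent_mem_prefixIdeal hf _) (h b b.2)
  rw [mem_monomials.1 (getD_monomials_mem hbl)] at hh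
  have hpφ : φ p = 0 := hspan (mem_span_rowPoly hf w i.2
    (R := {r | IsF5Row w f deg d (i + 1) r}) (fun r h1 h2 h3 => ⟨h1, h2, h3⟩) hp hh)
  rw [hφ, Finset.sum_eq_single_of_mem b (Finset.mem_univ b)] at hpφ
  · refine mul_ne_zero hb.2 ?_ hpφ
    rw [← hdeg]
    exact w.coeff_degree_ne_zero_iff.2 h0
  · intro a _ hab
    rcases lt_or_gt_of_ne hab with hlt | hlt
    · rw [w.coeff_eq_zero_of_lt, mul_zero]
      rw [hdeg]
      exact toSyn_getD_monomials_lt hlt hbl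
    · have : c a = 0 := by
        by_contra hca
        exact absurd (hmax a (by simp [hca])) (not_le.2 hlt)
      rw [this, zero_mul]

/-- A linear form vanishing on all truncated rows is a relation between the columns, so the rows
span and a basis can be extracted from them. -/
lemma exists_minor_ne_zero (w : MonomialOrder (Fin n)) (f : Fin s → MvPolynomial (Fin n) K)
    (deg : Fin s → ℕ) (d : ℕ) (i : Fin s) :
    ∃ e : Fin (freeColumns w f deg d i) ↪ F5Row w f deg d i,
      Matrix.det (fun a b : Fin (freeColumns w f deg d i) => f5Matrix w f deg d i (e a) b) ≠ 0 := by
  classical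
  have hli : LinearIndependent K
      (fun (j : Fin (freeColumns w f deg d i)) r => f5Matrix w f deg d i r j) :=
    Nat.findGreatest_spec (P := fun l =>
      LinearIndependent K (fun (j : Fin l) r => f5Matrix w f deg d i r j)) (Nat.zero_le _)
      (linearIndependent_empty_type)
  generalize freeColumns w f deg d i = l at hli ⊢
  let ρ : F5Row w f deg d i → Fin l → K := fun r j => f5Matrix w f deg d i r j
  have htop : Submodule.span K (Set.range ρ) = ⊤ := by
    by_contra hne
    obtain ⟨φ, hφ, hker⟩ := Submodule.exists_le_ker_of_lt_top _ (lt_top_iff_ne_top.2 hne)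
    apply hφ
    refine LinearMap.pi_ext' fun j => LinearMap.ext_ring ?_
    refine Fintype.linearIndependent_iff.1 hli (fun j => φ (Pi.single j 1)) ?_ j
    ext r
    have h1 : φ (ρ r) = 0 := hker (Submodule.subset_span ⟨r, rfl⟩)
    rw [pi_eq_sum_univ' (ρ r), map_sum] at h1
    simp only [map_smul, smul_eq_mul] at h1
    simp only [Finset.sum_apply, Pi.smul_apply, smul_eq_mul, Pi.zero_apply]
    rw [← h1]
    refine Finset.sum_congr rfl fun j _ => ?_
    rw [mul_comm]
  obtain ⟨g, hg, -, hgli⟩ := Submodule.exists_fun_fin_finrank_span_eq K (Set.range ρ)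
  have hrank : Module.finrank K (Submodule.span K (Set.range ρ)) = l := by
    rw [htop, finrank_top, Module.finrank_fin_fun]
  revert g
  rw [hrank]
  intro g hg hgli
  choose e he using hg
  have hinj : Function.Injective e := by
    intro a b hab
    apply hgli.injective
    rw [← he, ← he, hab]
  refine ⟨⟨e, hinj⟩, ?_⟩
  have h2 : (fun a b : Fin l => f5Matrix w f deg d i (e a) b) = g := by
    ext a b
    exact congrFun (he a) b
  have h3 : IsUnit (Matrix.of g) := Matrix.linearIndependent_rows_iff_isUnit.1 hgli
  have h4 := ((Matrix.isUnit_iff_isUnit_det _).1 h3).ne_zero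
  rw [← h2] at h4
  exact h4

lemma val_coeff_rowPoly {v : AddValuation K (WithTop ℤ)} {c : WithTop ℤ}
    (hc : ∀ i u, c ≤ v ((f i).coeff u)) (r : Fin s × Mon n) (u : Mon n) :
    c ≤ v ((rowPoly f r).coeff u) := by
  rw [rowPoly, coeff_monomial_mul']
  split_ifs
  · rw [one_mul]
    exact hc _ _
  · rw [v.map_zero]
    exact le_top

end FreeColumns

section Step

open Approx MvPolynomial

variable {K : Type*} [Field K] {v : AddValuation K (WithTop ℤ)} {n s : ℕ}
  {w : MonomialOrder (Fin n)} {f : Fin s → MvPolynomial (Fin n) K} {deg : Fin s → ℕ}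

/-! ## Correctness of the echelon forms -/

lemma degree_single (j : Fin n) : (Finsupp.single j 1 : Mon n).degree = 1 := by
  simp

lemma shift_contains {d : ℕ} {r : Row v n} {x : MvPolynomial (Fin n) K}
    (h : RowContains d r x) (α : Mon n) :
    RowContains (α.degree + d) (shift α r) (monomial α 1 * x) := by
  intro u hu
  rw [coeff_monomial_mul', shift]
  split_ifs with hα
  · rw [one_mul]
    refine h _ ?_
    have h1 : α.degree + (u - α).degree = u.degree := by
      rw [← map_add, add_tsub_cancel_of_le hα]
    omega
  · rw [exactZero_contains_iff]

lemma shift_ord {d : ℕ} {r : Row v n} {e : WithTop ℤ}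
    (h : ∀ u : Mon n, u.degree = d → e ≤ (r u).ord) (α u : Mon n)
    (hu : u.degree = α.degree + d) : e ≤ (shift α r u).ord := by
  rw [shift]
  split_ifs with hα
  · refine h _ ?_
    have h1 : α.degree + (u - α).degree = u.degree := by
      rw [← map_add, add_tsub_cancel_of_le hα]
    omega
  · exact le_top

lemma lead_eq_of_contains {d : ℕ} {E : EchelonRow v n} (hd : E.lead.degree = d)
    (hz : ∀ u : Mon n, u.degree = d → w.toSyn E.lead < w.toSyn u → E.row u = exactZero v)
    (hcert : (E.row E.lead).NonzeroCertified) {x : MvPolynomial (Fin n) K}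
    (hx : x.IsHomogeneous d) (hc : RowContains d E.row x) : x ≠ 0 ∧ w.degree x = E.lead := by
  have hne := ne_zero_of_contains (hc _ hd) hcert
  refine ⟨fun h0 => hne (by rw [h0, coeff_zero]), ?_⟩
  apply w.toSyn.injective
  refine le_antisymm (w.degree_le_iff.2 fun u hu => ?_) (w.le_degree (mem_support_iff.2 hne))
  by_contra hlt
  rw [mem_support_iff] at hu
  have hud : u.degree = d := by
    by_contra hud
    exact hu (hx.coeff_eq_zero hud)
  have h1 := hc u hud
  rw [hz u hud (not_le.1 hlt), exactZero_contains_iff] at h1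
  exact hu h1

/-- `f'` is a specialization of the input of the algorithm. -/
def IsSpec (v : AddValuation K (WithTop ℤ)) (m : ℕ) (f : Fin s → MvPolynomial (Fin n) K)
    (deg : Fin s → ℕ) (f' : Fin s → MvPolynomial (Fin n) K) : Prop :=
  ∀ i, (approxPoly v m (deg i) (f i)).Contains (f' i)

lemma isSpec_self (m : ℕ) (hf : ∀ i, (f i).IsHomogeneous (deg i)) : IsSpec v m f deg f :=
  fun i => ⟨hf i, fun _ _ => rfl⟩

/-- What is required of a row in degree `d` of an echelon matrix of the first `k` polynomials. -/
structure GoodRow (w : MonomialOrder (Fin n)) (f : Fin s → MvPolynomial (Fin n) K)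
    (deg : Fin s → ℕ) (m : ℕ) (P : ℤ) (d k : ℕ) (E : EchelonRow v n) : Prop where
  degree : E.lead.degree = d
  zero : ∀ u : Mon n, u.degree = d → w.toSyn E.lead < w.toSyn u → E.row u = exactZero v
  cert : (E.row E.lead).NonzeroCertified
  spec : ∀ f', IsSpec v m f deg f' →
    ∃ x ∈ prefixIdeal f' k, x.IsHomogeneous d ∧ RowContains d E.row x
  ord : ∀ u : Mon n, u.degree = d → ((m - P : ℤ) : WithTop ℤ) ≤ (E.row u).ord

variable {m : ℕ} {P : ℤ} {d k : ℕ} {E : EchelonRow v n}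

lemma GoodRow.lead_eq (h : GoodRow w f deg m P d k E) {x : MvPolynomial (Fin n) K}
    (hx : x.IsHomogeneous d) (hc : RowContains d E.row x) : x ≠ 0 ∧ w.degree x = E.lead :=
  lead_eq_of_contains h.degree h.zero h.cert hx hc

lemma GoodRow.lead_mem (h : GoodRow w f deg m P d k E) {f' : Fin s → MvPolynomial (Fin n) K}
    (hf' : IsSpec v m f deg f') : E.lead ∈ LM w (prefixIdeal f' k) := by
  obtain ⟨x, hx, hxd, hc⟩ := h.spec f' hf'
  exact ⟨x, hx, h.lead_eq hxd hc⟩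

lemma GoodRow.mul (h : GoodRow w f deg m P d k E) (j : Fin n) :
    GoodRow w f deg m P (d + 1) k
      ⟨Finsupp.single j 1 + E.lead, shift (Finsupp.single j 1) E.row⟩ where
  degree := by
    rw [map_add, degree_single, h.degree, add_comm]
  zero := by
    intro u hu hlt
    simp only [shift]
    split_ifs with hj
    · have hu' : Finsupp.single j 1 + (u - Finsupp.single j 1) = u := add_tsub_cancel_of_le hj
      apply h.zero
      · rw [← hu', map_add, degree_single] at hu
        omega
      · rw [← hu'] at hlt
        simpa using hlt
    · rfl
  cert := by
    simp only [shift]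
    rw [if_pos (le_self_add), add_tsub_cancel_left]
    exact h.cert
  spec := by
    intro f' hf'
    obtain ⟨x, hx, hxd, hc⟩ := h.spec f' hf'
    refine ⟨monomial (Finsupp.single j 1) 1 * x, Ideal.mul_mem_left _ _ hx, ?_, ?_⟩
    · rw [add_comm]
      exact (isHomogeneous_monomial 1 (degree_single j)).mul hxd
    · have := shift_contains hc (Finsupp.single j 1)
      rwa [degree_single, add_comm] at this
  ord := by
    intro u hu
    exact shift_ord h.ord _ _ (by rw [hu, degree_single, add_comm])

/-- What is required of an echelon matrix in degree `d` of the first `k` polynomials. -/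
structure GoodMatrix (w : MonomialOrder (Fin n)) (f : Fin s → MvPolynomial (Fin n) K)
    (deg : Fin s → ℕ) (m : ℕ) (P : ℤ) (d k : ℕ) (T : List (EchelonRow v n)) : Prop where
  row : ∀ E ∈ T, GoodRow w f deg m P d k E
  lead : ∀ u : Mon n, u.degree = d → u ∈ LM w (prefixIdeal f k) → u ∈ T.map EchelonRow.lead

/-- Hence the criterion tested by the algorithm on computed rows is the exact F5 criterion for `f`.
-/
lemma GoodMatrix.mem_lead_iff {T : List (EchelonRow v n)} (h : GoodMatrix w f deg m P d k T)
    (hf : ∀ i, (f i).IsHomogeneous (deg i)) {u : Mon n} (hu : u.degree = d) :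
    u ∈ T.map EchelonRow.lead ↔ u ∈ LM w (prefixIdeal f k) := by
  refine ⟨fun hmem => ?_, h.lead u hu⟩
  obtain ⟨E, hE, rfl⟩ := List.mem_map.1 hmem
  exact (h.row E hE).lead_mem (isSpec_self m hf)

/-- A row of a Macaulay matrix of the input. -/
noncomputable def rowApprox (v : AddValuation K (WithTop ℤ)) (m : ℕ)
    (f : Fin s → MvPolynomial (Fin n) K) (deg : Fin s → ℕ) (r : Fin s × Mon n) : Row v n :=
  shift r.2 (approxPoly v m (deg r.1) (f r.1)).coeff

lemma rowApprox_contains {f' : Fin s → MvPolynomial (Fin n) K} (hf' : IsSpec v m f deg f')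
    {r : Fin s × Mon n} (hr : r.2.degree + deg r.1 = d) :
    RowContains d (rowApprox v m f deg r) (rowPoly f' r) := by
  rw [← hr]
  exact shift_contains (hf' r.1).2 r.2

lemma rowApprox_ord (r : Fin s × Mon n) (u : Mon n) :
    ((m : ℤ) : WithTop ℤ) ≤ (rowApprox v m f deg r u).ord := by
  rw [rowApprox, shift]
  split_ifs
  · exact le_rfl
  · exact le_top

/-! ### Completion of the pivot rows by multiples of earlier rows. -/

lemma findMultiple_some {prev : List (EchelonRow v n)} {u : Mon n} {T : EchelonRow v n}
    (h : findMultiple prev u = some T) :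
    T.lead = u ∧ ∃ Q ∈ prev, ∃ j,
      T = ⟨Finsupp.single j 1 + Q.lead, shift (Finsupp.single j 1) Q.row⟩ := by
  have hmem := List.mem_of_head? h
  rw [List.mem_filter, List.mem_flatMap] at hmem
  obtain ⟨⟨Q, hQ, hT⟩, hlead⟩ := hmem
  obtain ⟨j, -, rfl⟩ := List.mem_map.1 hT
  exact ⟨of_decide_eq_true hlead, Q, hQ, j, rfl⟩

lemma findMultiple_isSome {prev : List (EchelonRow v n)} {Q : EchelonRow v n} (hQ : Q ∈ prev)
    (j : Fin n) : ∃ T, findMultiple prev (Finsupp.single j 1 + Q.lead) = some T := by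
  rw [← Option.isSome_iff_exists, findMultiple, List.isSome_head?]
  apply List.ne_nil_of_mem
    (a := ⟨Finsupp.single j 1 + Q.lead, shift (Finsupp.single j 1) Q.row⟩)
  rw [List.mem_filter]
  exact ⟨List.mem_flatMap.2 ⟨Q, hQ, List.mem_map.2 ⟨j, List.mem_finRange j, rfl⟩⟩, by simp⟩

lemma filterMap_findMultiple_sublist (prev : List (EchelonRow v n)) (cs : List (Mon n)) :
    ((cs.filterMap (findMultiple prev)).map EchelonRow.lead).Sublist cs := by
  induction cs with
  | nil => simp
  | cons c cs ih =>
    rcases h : findMultiple prev c with _ | T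
    · rw [List.filterMap_cons_none h]
      exact ih.cons c
    · rw [List.filterMap_cons_some h, List.map_cons, (findMultiple_some h).1]
      exact ih.cons_cons c

/-- There is a minor of small valuation on the first `freeColumns` columns. -/
def HasSmallMinor (v : AddValuation K (WithTop ℤ)) (w : MonomialOrder (Fin n))
    (f : Fin s → MvPolynomial (Fin n) K) (deg : Fin s → ℕ) (c P : ℤ) (d : ℕ) (i : Fin s) : Prop :=
  ∃ (e : Fin (freeColumns w f deg d i) ↪ F5Row w f deg d i) (k : ℤ),
    v (Matrix.det fun a b : Fin (freeColumns w f deg d i) => f5Matrix w f deg d i (e a) b) = k ∧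
      k + freeColumns w f deg d i * (2 * c) ≤ P

/-- Pivot columns are leading monomials and form an initial segment, so there are at most
`freeColumns` of them; the small minor gives at least as many. -/
lemma gauss_good {c : ℤ} {i : Fin s} (hf : ∀ i, (f i).IsHomogeneous (deg i)) (hc : 0 ≤ c)
    (hP : P < m) (hval : ∀ i u, ((-c : ℤ) : WithTop ℤ) ≤ v ((f i).coeff u))
    (hminor : HasSmallMinor v w f deg c P d i) {R : List (Fin s × Mon n)}
    (hR : ∀ r, r ∈ R ↔ IsF5Row w f deg d (i + 1) r) :
    (gauss m (monomials w d) (R.map (rowApprox v m f deg))).val.length =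
        freeColumns w f deg d i ∧
      ∀ Q ∈ (gauss m (monomials w d) (R.map (rowApprox v m f deg))).val,
        GoodRow w f deg m P d (i + 1) Q := by
  have hd : ∀ u ∈ monomials w d, u.degree = d := fun u hu => mem_monomials.1 hu
  have hz : ∀ r : Row v n, ∀ u : Mon n, u.degree = d → u ∉ monomials w d → r u = exactZero v :=
    fun r u hu hnot => absurd (mem_monomials.2 hu) hnot
  set E := (gauss m (monomials w d) (R.map (rowApprox v m f deg))).val with hE
  have hpre : E.map EchelonRow.lead <+: monomials w d := gauss_leads_prefix _ _ _
  have hlead : ∀ Q ∈ E, Q.lead.degree = d :=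
    fun Q hQ => hd _ (hpre.subset (List.mem_map_of_mem hQ))
  have hspec : ∀ f', IsSpec v m f deg f' → ∀ Q ∈ E, (Q.row Q.lead).NonzeroCertified ∧
      ∃ x ∈ (prefixIdeal f' (i + 1)).restrictScalars K ⊓ homogeneousSubmodule (Fin n) K d,
        RowContains d Q.row x := by
    intro f' hf'
    refine gauss_spec m _ (monomials_nodup w d) hd ?_ fun r _ => hz r
    intro r' hr'
    obtain ⟨r, hr, rfl⟩ := List.mem_map.1 hr'
    have hr5 := (hR r).1 hr
    exact ⟨rowPoly f' r, ⟨rowPoly_mem hr5.1,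
      hr5.2.1 ▸ rowPoly_isHomogeneous (fun i => (hf' i).1) r⟩, rowApprox_contains hf' hr5.2.1⟩
  have hzero : ∀ Q ∈ E, ∀ u : Mon n, u.degree = d → w.toSyn Q.lead < w.toSyn u →
      Q.row u = exactZero v :=
    gauss_zero m w.toSyn (monomials_nodup w d) (monomials_pairwise w d) fun r _ => hz r
  have hweak : ∀ Q ∈ E, Q.lead ∈ LM w (prefixIdeal f (i + 1)) := by
    intro Q hQ
    obtain ⟨hcert, x, hx, hcx⟩ := hspec f (isSpec_self m hf) Q hQ
    obtain ⟨h0, hdeg⟩ := lead_eq_of_contains (hlead Q hQ) (hzero Q hQ) hcert hx.2 hcx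
    exact ⟨x, hx.1, h0, hdeg⟩
  have hlen : E.length ≤ (monomials w d).length := by simpa using hpre.length_le
  have hle : E.length ≤ freeColumns w f deg d i := by
    refine le_freeColumns hf hlen fun b hb => ?_
    have hb' : b < (E.map EchelonRow.lead).length := by simpa using hb
    rw [List.getD_eq_getElem _ _ (hb.trans_le hlen), ← hpre.getElem hb']
    rw [List.getElem_map]
    exact hweak _ (List.getElem_mem hb)
  obtain ⟨e, k, hk, hkP⟩ := hminor
  have hprec := gauss_precise (v := v) (m := m) (W := R.map fun r =>
      (rowApprox v m f deg r, rowPoly f r)) hc hP (monomials_nodup w d) hd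
    (freeColumns_le w f deg d i) le_rfl (fun w _ => hz w.1)
    (by
      intro x hx
      obtain ⟨r, hr, rfl⟩ := List.mem_map.1 hx
      exact rowApprox_contains (isSpec_self m hf) ((hR r).1 hr).2.1)
    (by
      intro x hx u _
      obtain ⟨r, hr, rfl⟩ := List.mem_map.1 hx
      exact val_coeff_rowPoly hval r u)
    (by
      intro x hx u _
      obtain ⟨r, hr, rfl⟩ := List.mem_map.1 hx
      rw [sub_zero]
      exact rowApprox_ord r u)
    (e := fun a => (rowApprox v m f deg (e a).1, rowPoly f (e a).1))
    (fun a => List.mem_map.2 ⟨(e a).1, (hR _).2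
      ⟨Nat.lt_succ_iff.2 (Fin.le_def.1 (e a).2.1), (e a).2.2.1, (e a).2.2.2⟩, rfl⟩)
    (k := k) hk (by linarith)
  rw [List.map_map] at hprec
  change _ ≤ E.length ∧ ∀ Q ∈ E.take _, _ at hprec
  have hlE := le_antisymm hle hprec.1
  refine ⟨hlE, fun Q hQ => ?_⟩
  refine ⟨hlead Q hQ, hzero Q hQ, (hspec f (isSpec_self m hf) Q hQ).1, ?_, ?_⟩
  · intro f' hf'
    obtain ⟨x, hx, hcx⟩ := (hspec f' hf' Q hQ).2
    exact ⟨x, hx.1, hx.2, hcx⟩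
  · refine hprec.2 Q ?_
    rwa [← hlE, List.take_length]

/-- The completion of the echelon form succeeds. -/
lemma complete_good {c : ℤ} {i : Fin s} (hf : ∀ i, (f i).IsHomogeneous (deg i))
    (hreg : RingTheory.Sequence.IsRegular (MvPolynomial (Fin n) K) (List.ofFn f))
    (hweak : IsWeaklyIdeal w (prefixIdeal f (i + 1))) (hc : 0 ≤ c)
    (hP : P < m) (hval : ∀ i u, ((-c : ℤ) : WithTop ℤ) ≤ v ((f i).coeff u))
    (hminor : HasSmallMinor v w f deg c P d i) {R : List (Fin s × Mon n)} (hRn : R.Nodup)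
    (hR : ∀ r, r ∈ R ↔ IsF5Row w f deg d (i + 1) r) {prev E : List (EchelonRow v n)}
    (hprev : ∀ Q ∈ prev, ∃ d', d = d' + 1 ∧ GoodRow w f deg m P d' (i + 1) Q)
    (hprevlead : ∀ u : Mon n, u.degree + 1 = d → u ∈ LM w (prefixIdeal f (i + 1)) →
      u ∈ prev.map EchelonRow.lead)
    (hE : E = (gauss m (monomials w d) (R.map (rowApprox v m f deg))).val) :
    ∃ E', complete prev E R.length ((monomials w d).drop E.length) = some E' ∧
      GoodMatrix w f deg m P d (i + 1) E' := by
  classical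
  obtain ⟨hlen, hgood⟩ := gauss_good hf hc hP hval hminor hR
  have hpre : E.map EchelonRow.lead <+: monomials w d := by
    rw [hE]
    exact gauss_leads_prefix _ _ _
  rw [← hE] at hlen hgood
  set l := freeColumns w f deg d i with hl
  have htake : E.map EchelonRow.lead = (monomials w d).take E.length := by
    simpa using List.prefix_iff_eq_take.1 hpre
  set T := ((monomials w d).drop E.length).filterMap (findMultiple prev) with hT
  have hTgood : ∀ Q ∈ T, GoodRow w f deg m P d (i + 1) Q := by
    intro Q hQ
    obtain ⟨u, -, hu⟩ := List.mem_filterMap.1 hQ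
    obtain ⟨-, Q', hQ', j, rfl⟩ := findMultiple_some hu
    obtain ⟨d', rfl, hQ''⟩ := hprev Q' hQ'
    exact hQ''.mul j
  have hETgood : ∀ Q ∈ E ++ T, GoodRow w f deg m P d (i + 1) Q := by
    intro Q hQ
    rcases List.mem_append.1 hQ with hQ | hQ
    · exact hgood Q hQ
    · exact hTgood Q hQ
  have hsub : ((E ++ T).map EchelonRow.lead).Sublist (monomials w d) := by
    rw [List.map_append, htake]
    conv_rhs => rw [← List.take_append_drop E.length (monomials w d)]
    exact (List.Sublist.refl _).append (filterMap_findMultiple_sublist _ _)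
  have hcover : ∀ u : Mon n, u.degree = d → u ∈ LM w (prefixIdeal f (i + 1)) →
      u ∈ (E ++ T).map EchelonRow.lead := by
    intro u hu huLM
    rw [List.map_append, List.mem_append]
    have hmem : u ∈ monomials w d := mem_monomials.2 hu
    rw [← List.take_append_drop E.length (monomials w d), List.mem_append] at hmem
    rcases hmem with hmem | hmem
    · left
      rwa [htake]
    · right
      -- Otherwise `u` is a minimal leading monomial. The weak hypothesis makes all columns up to
      -- that of `u` leading, hence independent, though `u` lies beyond the `freeColumns` first
      -- ones.
      have hdiv : ∃ j, Finsupp.single j 1 ≤ u ∧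
          u - Finsupp.single j 1 ∈ LM w (prefixIdeal f (i + 1)) := by
        by_contra! hmin
        obtain ⟨a, ha, hau⟩ := List.mem_iff_getElem.1 hmem
        rw [List.getElem_drop] at hau
        rw [List.length_drop] at ha
        have hlt : E.length + a < (monomials w d).length := by omega
        have : E.length + a + 1 ≤ freeColumns w f deg d i := by
          refine le_freeColumns hf hlt fun b hb => ?_
          rcases Nat.lt_succ_iff_lt_or_eq.1 hb with hb | rfl
          · refine hweak.mem_LM huLM hmin ?_ ?_
            · rw [hu]
              exact mem_monomials.1 (getD_monomials_mem (hb.trans hlt))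
            · have := toSyn_getD_monomials_lt hb hlt
              rwa [List.getD_eq_getElem _ _ hlt, hau] at this
          · rwa [List.getD_eq_getElem _ _ hlt, hau]
        omega
      obtain ⟨j, hj, hjLM⟩ := hdiv
      have hju : Finsupp.single j 1 + (u - Finsupp.single j 1) = u := add_tsub_cancel_of_le hj
      have hdeg : (u - Finsupp.single j 1).degree + 1 = d := by
        rw [← hu]
        conv_rhs => rw [← hju, map_add, degree_single]
        exact add_comm _ _
      obtain ⟨Q, hQ, hQu⟩ := List.mem_map.1 (hprevlead _ hdeg hjLM)
      obtain ⟨T', hT'⟩ := findMultiple_isSome hQ j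
      rw [hQu, hju] at hT'
      exact List.mem_map.2 ⟨T', List.mem_filterMap.2 ⟨u, hmem, hT'⟩, (findMultiple_some hT').1⟩
  -- The leads of `E ++ T` are distinct and are exactly the leading monomials of degree `d`, which
  -- the F5 rows count.
  have hcard : (E ++ T).length = R.length := by
    rw [length_eq_card_LMdeg hf hreg i.2 hRn hR,
      ← List.length_map (f := EchelonRow.lead),
      ← List.toFinset_card_of_nodup (hsub.nodup (monomials_nodup w d))]
    congr 1
    ext u
    rw [List.mem_toFinset, mem_LMdeg]
    constructor
    · intro hu
      refine ⟨mem_monomials.1 (hsub.subset hu), ?_⟩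
      obtain ⟨Q, hQ, rfl⟩ := List.mem_map.1 hu
      exact (hETgood Q hQ).lead_mem (isSpec_self m hf)
    · rintro ⟨h1, h2⟩
      exact hcover u h1 h2
  rw [List.length_append] at hcard
  refine ⟨E ++ T, ?_, hETgood, hcover⟩
  rw [complete]
  simp only [← hT]
  rw [if_pos (by omega), List.take_of_length_le (by omega)]

end Step

section Loops

open Approx MvPolynomial

variable {K : Type*} [Field K] {v : AddValuation K (WithTop ℤ)} {n s : ℕ}
  {w : MonomialOrder (Fin n)} {f : Fin s → MvPolynomial (Fin n) K} {deg : Fin s → ℕ}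
  {m : ℕ} {P : ℤ} {d i : ℕ}

/-! ## The loops of the algorithm -/

/-- The matrices in degree `d` of the first `i` polynomials, and the previous ones, have been
treated. -/
def Treated (d i d' k : ℕ) : Prop := d' < d ∨ (d' = d ∧ k ≤ i) ∨ k = 0

/-- The invariant of the loops. -/
structure Invariant (w : MonomialOrder (Fin n)) (f : Fin s → MvPolynomial (Fin n) K)
    (deg : Fin s → ℕ) (m : ℕ) (P : ℤ) (d i : ℕ) (S : State v n) : Prop where
  tilde : ∀ d' k, k ≤ s → Treated d i d' k → GoodMatrix w f deg m P d' k (S.tilde d' k)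
  basis : ∀ Q ∈ S.basis, ∃ d' k, k ≤ s ∧ GoodRow w f deg m P d' k Q
  lead : ∀ d' k, k ≤ s → Treated d i d' k →
    ∀ Q ∈ S.tilde d' k, Q.lead ∈ S.basis.map EchelonRow.lead

lemma invariant_init : Invariant w f deg m P 0 0 (⟨fun _ _ => [], []⟩ : State v n) where
  tilde := by
    intro d' k _ h
    obtain rfl : k = 0 := by
      rcases h with h | h | h <;> omega
    refine ⟨by simp, ?_⟩
    rintro u - ⟨p, hp, h0, -⟩
    rw [prefixIdeal_zero, Ideal.mem_bot] at hp
    exact absurd hp h0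
  basis := by simp
  lead := by simp

lemma Invariant.succ {S : State v n} (h : Invariant w f deg m P d s S) :
    Invariant w f deg m P (d + 1) 0 S where
  tilde := fun d' k hk ht => h.tilde d' k hk (by unfold Treated at *; omega)
  basis := h.basis
  lead := fun d' k hk ht => h.lead d' k hk (by unfold Treated at *; omega)

/-- The computed leads in degree `d - deg i` are the true leading monomials, so the rows selected at
run time are exactly those indexed by the F5 criterion for `f`. -/
lemma newRows_eq (hf : ∀ i, (f i).IsHomogeneous (deg i)) {S : State v n} {i : Fin s}
    (hS : deg i ≤ d → GoodMatrix w f deg m P (d - deg i) i (S.tilde (d - deg i) i)) :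
    ∃ R : List (Fin s × Mon n), R.Nodup ∧
      (∀ r, r ∈ R ↔ r.1 = i ∧ r.2.degree + deg r.1 = d ∧ r.2 ∉ LM w (prefixIdeal f r.1)) ∧
      newRows w (fun i => approxPoly v m (deg i) (f i)) S d i =
        R.map (rowApprox v m f deg) := by
  classical
  by_cases hd : deg i ≤ d
  · refine ⟨((monomials w (d - deg i)).filter (fun α =>
      decide (α ∉ (S.tilde (d - deg i) (i : ℕ)).map EchelonRow.lead))).map (Prod.mk i), ?_, ?_, ?_⟩
    · exact ((monomials_nodup w _).filter _).map fun a b h => (Prod.mk.inj h).2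
    · rintro ⟨j, u⟩
      rw [List.mem_map]
      constructor
      · rintro ⟨α, hα, h⟩
        obtain ⟨rfl, rfl⟩ := Prod.mk.inj h
        rw [List.mem_filter, mem_monomials, decide_eq_true_iff] at hα
        have := hα.1
        refine ⟨rfl, by simp only; omega, ?_⟩
        rw [← (hS hd).mem_lead_iff hf hα.1]
        exact hα.2
      · rintro ⟨h1, h2, h3⟩
        simp only at h1 h2 h3
        subst h1
        refine ⟨u, ?_, rfl⟩
        have hu : u.degree = d - deg j := by omega
        rw [List.mem_filter, mem_monomials, decide_eq_true_iff, (hS hd).mem_lead_iff hf hu]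
        exact ⟨hu, h3⟩
    · rw [newRows]
      rw [if_pos (show (approxPoly v m (deg i) (f i)).deg ≤ d from hd), List.map_map]
      rfl
  · refine ⟨[], List.nodup_nil, ?_, ?_⟩
    · rintro ⟨j, u⟩
      simp only [List.not_mem_nil, false_iff, not_and]
      rintro rfl h
      omega
    · rw [newRows, if_neg (show ¬ (approxPoly v m (deg i) (f i)).deg ≤ d from hd)]
      rfl

/-- The hypotheses on the input and on the precision. -/
structure Hypotheses (v : AddValuation K (WithTop ℤ)) (w : MonomialOrder (Fin n))
    (f : Fin s → MvPolynomial (Fin n) K) (deg : Fin s → ℕ) (m D : ℕ) (c P : ℤ) : Prop where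
  homogeneous : ∀ i, (f i).IsHomogeneous (deg i)
  regular : RingTheory.Sequence.IsRegular (MvPolynomial (Fin n) K) (List.ofFn f)
  weakly : ∀ i : Fin s, IsWeaklyIdeal w (prefixIdeal f (i + 1))
  nonneg : 0 ≤ c
  prec : P < m
  val : ∀ i u, ((-c : ℤ) : WithTop ℤ) ≤ v ((f i).coeff u)
  minor : ∀ d ≤ D, ∀ i, HasSmallMinor v w f deg c P d i

variable {D : ℕ} {c : ℤ}

lemma cost_gauss_le_cube (hf : ∀ i, (f i).IsHomogeneous (deg i))
    (hreg : RingTheory.Sequence.IsRegular (MvPolynomial (Fin n) K) (List.ofFn f)) {k : ℕ}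
    (hk : k ≤ s) {R : List (Fin s × Mon n)} (hRn : R.Nodup)
    (hR : ∀ r, r ∈ R ↔ IsF5Row w f deg d k r) :
    (gauss m (monomials w d) (R.map (rowApprox v m f deg))).cost ≤
      5 * (n + d - 1).choose d ^ 3 := by
  refine (cost_gauss_le _ _ _).trans ?_
  have hN : R.length ≤ (n + d - 1).choose d := by
    rw [length_eq_card_LMdeg hf hreg hk hRn hR, ← length_monomials w d]
    exact card_LMdeg_le w _ d
  rw [List.length_map, length_monomials]
  generalize (n + d - 1).choose d = L at hN ⊢
  have h1 : R.length * (2 * L + 3) ≤ L * (5 * L) := by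
    rcases Nat.eq_zero_or_pos L with rfl | hL
    · simp at hN
      simp [hN]
    · exact Nat.mul_le_mul hN (by omega)
  calc L * (R.length * (2 * L + 3)) ≤ L * (L * (5 * L)) := Nat.mul_le_mul_left _ h1
    _ = 5 * L ^ 3 := by ring

lemma innerLoop_cons_some {F : Fin s → APoly v n} {j : Fin s} {is : List (Fin s)}
    {M : List (Row v n)} {S : State v n} {E' : List (EchelonRow v n)}
    (h : complete (if d = 0 then [] else S.tilde (d - 1) ((j : ℕ) + 1))
      (gauss m (monomials w d) (M ++ newRows w F S d j)).val (M ++ newRows w F S d j).length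
      ((monomials w d).drop (gauss m (monomials w d) (M ++ newRows w F S d j)).val.length) =
        some E') :
    ∃ new : List (EchelonRow v n),
      (∀ Q, Q ∈ new ↔ Q ∈ E' ∧ Q.lead ∉ S.basis.map EchelonRow.lead) ∧
      (innerLoop m w F d (j :: is) M S).val = (innerLoop m w F d is (M ++ newRows w F S d j)
        ⟨Function.update S.tilde d (Function.update (S.tilde d) ((j : ℕ) + 1) E'),
          S.basis ++ new⟩).val ∧
      (innerLoop m w F d (j :: is) M S).cost =
        (gauss m (monomials w d) (M ++ newRows w F S d j)).cost +
        (innerLoop m w F d is (M ++ newRows w F S d j)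
        ⟨Function.update S.tilde d (Function.update (S.tilde d) ((j : ℕ) + 1) E'),
          S.basis ++ new⟩).cost := by
  classical
  simp only [innerLoop, Counted.val_bind, Counted.cost_bind]
  rw [h]
  refine ⟨_, fun Q => ?_, rfl, rfl⟩
  rw [List.mem_filter, decide_eq_true_iff]

lemma Invariant.update {S : State v n} (h : Invariant w f deg m P d i S) (hi : i < s)
    {E' new : List (EchelonRow v n)} (hE' : GoodMatrix w f deg m P d (i + 1) E')
    (hnew : ∀ Q, Q ∈ new ↔ Q ∈ E' ∧ Q.lead ∉ S.basis.map EchelonRow.lead) :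
    Invariant w f deg m P d (i + 1)
      ⟨Function.update S.tilde d (Function.update (S.tilde d) (i + 1) E'), S.basis ++ new⟩ := by
  have hold : ∀ d' k, ¬ (d' = d ∧ k = i + 1) →
      Function.update S.tilde d (Function.update (S.tilde d) (i + 1) E') d' k = S.tilde d' k := by
    intro d' k hne
    by_cases hd : d' = d
    · subst hd
      rw [Function.update_self, Function.update_of_ne fun hk => hne ⟨rfl, hk⟩]
    · rw [Function.update_of_ne hd]
  have hself : Function.update S.tilde d (Function.update (S.tilde d) (i + 1) E') d (i + 1) =
      E' := by
    rw [Function.update_self, Function.update_self]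
  refine ⟨?_, ?_, ?_⟩
  · intro d' k hk ht
    by_cases hne : d' = d ∧ k = i + 1
    · obtain ⟨rfl, rfl⟩ := hne
      simp only [hself]
      exact hE'
    · simp only [hold d' k hne]
      exact h.tilde d' k hk (by unfold Treated at *; omega)
  · intro Q hQ
    rcases List.mem_append.1 hQ with hQ | hQ
    · exact h.basis Q hQ
    · exact ⟨d, i + 1, hi, hE'.row Q ((hnew Q).1 hQ).1⟩
  · intro d' k hk ht Q hQ
    simp only [List.map_append, List.mem_append]
    by_cases hne : d' = d ∧ k = i + 1
    · obtain ⟨rfl, rfl⟩ := hne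
      simp only [hself] at hQ
      by_cases hmem : Q.lead ∈ S.basis.map EchelonRow.lead
      · exact Or.inl hmem
      · exact Or.inr (List.mem_map_of_mem ((hnew Q).2 ⟨hQ, hmem⟩))
    · simp only [hold d' k hne] at hQ
      exact Or.inl (h.lead d' k hk (by unfold Treated at *; omega) Q hQ)

lemma innerLoop_good (H : Hypotheses v w f deg m D c P) (hd : d ≤ D) {is : List (Fin s)}
    (hi : i ≤ s) (his : is = (List.finRange s).drop i) {S : State v n}
    (hS : Invariant w f deg m P d i S) {R : List (Fin s × Mon n)} (hRn : R.Nodup)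
    (hR : ∀ r, r ∈ R ↔ IsF5Row w f deg d i r) :
    ∃ S', (innerLoop m w (fun i => approxPoly v m (deg i) (f i)) d is
        (R.map (rowApprox v m f deg)) S).val = some S' ∧
      Invariant w f deg m P d s S' ∧
      (innerLoop m w (fun i => approxPoly v m (deg i) (f i)) d is
        (R.map (rowApprox v m f deg)) S).cost ≤ is.length * (5 * (n + d - 1).choose d ^ 3) := by
  classical
  induction is generalizing i S R with
  | nil =>
    have hlen := congrArg List.length his
    simp only [List.length_nil, List.length_drop, List.length_finRange] at hlen
    obtain rfl : i = s := by omega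
    exact ⟨S, rfl, hS, by simp [innerLoop]⟩
  | cons j is ih =>
    have hlen := congrArg List.length his
    simp only [List.length_cons, List.length_drop, List.length_finRange] at hlen
    have his' : i < s := by omega
    rw [List.drop_eq_getElem_cons (by simpa using his'), List.getElem_finRange,
      List.cons.injEq] at his
    obtain ⟨hj, his⟩ := his
    obtain rfl : (j : ℕ) = i := by simp [hj]
    have hpos := deg_pos_of_isRegular H.homogeneous H.regular j
    obtain ⟨R', hR'n, hR', hnew⟩ := newRows_eq (w := w) (m := m) (P := P) (d := d)
      H.homogeneous (S := S) (i := j)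
      (fun hle => hS.tilde _ _ j.2.le (Or.inl (by omega)))
    have hRR' : ∀ r, r ∈ R ++ R' ↔ IsF5Row w f deg d (j + 1) r := by
      intro r
      rw [List.mem_append, hR, hR', IsF5Row, IsF5Row, Fin.ext_iff, Nat.lt_succ_iff_lt_or_eq,
        or_and_right]
    have hRR'n : (R ++ R').Nodup := by
      refine List.Nodup.append hRn hR'n fun r hr hr' => ?_
      have h1 := ((hR r).1 hr).1
      rw [((hR' r).1 hr').1] at h1
      exact lt_irrefl _ h1
    have hM : R.map (rowApprox v m f deg) ++
        newRows w (fun i => approxPoly v m (deg i) (f i)) S d j =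
        (R ++ R').map (rowApprox v m f deg) := by
      rw [hnew, List.map_append]
    obtain ⟨E', hE', hgood⟩ := complete_good (d := d) H.homogeneous H.regular (H.weakly j) H.nonneg
      H.prec H.val (H.minor d hd j) hRR'n hRR'
      (prev := if d = 0 then [] else S.tilde (d - 1) ((j : ℕ) + 1))
      (by
        intro Q hQ
        split_ifs at hQ with h0
        · simp at hQ
        · exact ⟨d - 1, by omega, (hS.tilde _ _ j.2 (Or.inl (by omega))).row Q hQ⟩)
      (by
        intro u hu huLM
        rw [if_neg (by omega)]
        exact (hS.tilde _ _ j.2 (Or.inl (by omega))).lead u (by omega) huLM) rfl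
    obtain ⟨new, hnew', hloop⟩ := innerLoop_cons_some (w := w) (m := m) (d := d)
      (F := fun i => approxPoly v m (deg i) (f i)) (j := j) (is := is)
      (M := R.map (rowApprox v m f deg)) (S := S) (E' := E')
      (by
        rw [hM, List.length_map]
        exact hE')
    rw [hM] at hloop
    rw [hloop.1, hloop.2]
    obtain ⟨S', hS', hinv, hcost⟩ := ih (i := j + 1) j.2 his
      (hS.update j.2 hgood hnew') hRR'n hRR'
    refine ⟨S', hS', hinv, ?_⟩
    rw [List.length_cons, add_one_mul, add_comm]
    exact Nat.add_le_add hcost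
      (cost_gauss_le_cube (m := m) H.homogeneous H.regular j.2 hRR'n hRR')

/-- False for `n = 0`: there is one monomial in degree zero and none above. -/
lemma choose_mono (hn : 0 < n) (hd : d ≤ D) : (n + d - 1).choose d ≤ (n + D - 1).choose D := by
  obtain ⟨k, rfl⟩ : ∃ k, n = k + 1 := ⟨n - 1, by omega⟩
  have h : ∀ e, (k + 1 + e - 1).choose e = (k + e).choose k := by
    intro e
    rw [Nat.choose_symm_add]
    congr 1
    omega
  rw [h, h]
  exact Nat.choose_le_choose _ (by omega)

lemma outerLoop_good (H : Hypotheses v w f deg m D c P) {ds : List ℕ}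
    (hi : d ≤ D + 1) (hds : ds = (List.range (D + 1)).drop d) {S : State v n}
    (hS : Invariant w f deg m P d 0 S) :
    ∃ S', (outerLoop m w (fun i => approxPoly v m (deg i) (f i)) ds S).val = some S' ∧
      Invariant w f deg m P (D + 1) 0 S' ∧
      (outerLoop m w (fun i => approxPoly v m (deg i) (f i)) ds S).cost ≤
        ds.length * (s * (5 * (n + D - 1).choose D ^ 3)) := by
  induction ds generalizing d S with
  | nil =>
    have hlen := congrArg List.length hds
    simp only [List.length_nil, List.length_drop, List.length_range] at hlen
    obtain rfl : d = D + 1 := by omega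
    exact ⟨S, rfl, hS, by simp [outerLoop]⟩
  | cons d' ds ih =>
    have hlen := congrArg List.length hds
    simp only [List.length_cons, List.length_drop, List.length_range] at hlen
    have hdD : d < D + 1 := by omega
    rw [List.drop_eq_getElem_cons (by simpa using hdD), List.getElem_range,
      List.cons.injEq] at hds
    obtain ⟨rfl, hds⟩ := hds
    obtain ⟨S₁, hS₁, hinv₁, hcost₁⟩ := innerLoop_good H (d := d') (by omega) (Nat.zero_le s)
      (is := List.finRange s) (by simp) hS (R := []) List.nodup_nil (by simp [IsF5Row])
    rw [List.map_nil] at hS₁ hcost₁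
    obtain ⟨S', hS', hinv, hcost⟩ := ih (d := d' + 1) hdD hds hinv₁.succ
    refine ⟨S', ?_, hinv, ?_⟩
    · simp only [outerLoop, Counted.val_bind]
      rw [hS₁]
      exact hS'
    · simp only [outerLoop, Counted.cost_bind]
      rw [hS₁, List.length_cons, add_one_mul, add_comm]
      refine Nat.add_le_add hcost (hcost₁.trans ?_)
      rw [List.length_finRange]
      rcases Nat.eq_zero_or_pos s with rfl | hs
      · simp
      · have hn := pos_of_isRegular H.homogeneous H.regular ⟨0, hs⟩
        have := choose_mono hn (Nat.lt_succ_iff.1 hdD)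
        gcongr

/-- Correctness of the weak Matrix-F5 algorithm. -/
theorem weakMF5_correct (H : Hypotheses v w f deg m D c P) :
    ∃ G : List (APoly v n),
      (weakMF5 m w D fun i => approxPoly v m (deg i) (f i)).val = some G ∧
      IsApproxDGroebner w D (fun i => approxPoly v m (deg i) (f i)) G ∧
      (∀ Q ∈ G, ∀ u : Mon n, u.degree = Q.deg →
        ((m - P : ℤ) : WithTop ℤ) ≤ (Q.coeff u).ord) ∧
      (1 ≤ D → (weakMF5 m w D fun i => approxPoly v m (deg i) (f i)).cost ≤
        10 * (s * D * (n + D - 1).choose D ^ 3)) := by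
  have hf := H.homogeneous
  obtain ⟨S, hS, hinv, hcost⟩ := outerLoop_good H (d := 0) (Nat.zero_le _)
    (ds := List.range (D + 1)) (by simp) invariant_init
  have hval : (weakMF5 m w D fun i => approxPoly v m (deg i) (f i)).val =
      some (S.basis.map fun P => ⟨P.lead.degree, P.row⟩) := by
    simp only [weakMF5, Counted.val_bind]
    rw [hS]
    rfl
  have hcost' : (weakMF5 m w D fun i => approxPoly v m (deg i) (f i)).cost ≤
      (D + 1) * (s * (5 * (n + D - 1).choose D ^ 3)) := by
    simp only [weakMF5, Counted.cost_bind]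
    rw [hS]
    simpa using hcost
  have hord : ∀ Q ∈ S.basis.map fun P => (⟨P.lead.degree, P.row⟩ : APoly v n),
      ∀ u : Mon n, u.degree = Q.deg → ((m - P : ℤ) : WithTop ℤ) ≤ (Q.coeff u).ord := by
    intro Q hQ
    obtain ⟨E, hE, rfl⟩ := List.mem_map.1 hQ
    obtain ⟨d', k, -, hE'⟩ := hinv.basis E hE
    intro u hu
    exact hE'.ord u (hu.trans hE'.degree)
  refine ⟨_, hval, ⟨?_, ?_, ?_⟩, hord, ?_⟩
  · intro Q hQ u hu
    refine le_trans ?_ (hord Q hQ u hu)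
    have := H.prec
    exact_mod_cast (by omega : (0 : ℤ) ≤ m - P)
  · intro f' hf'
    have hf'h : ∀ i, (f' i).IsHomogeneous (deg i) := fun i => (hf' i).1
    have hrep : ∀ j : Fin (S.basis.map fun P => (⟨P.lead.degree, P.row⟩ : APoly v n)).length,
        ∃ x ∈ prefixIdeal f' s, ((S.basis.map fun P =>
          (⟨P.lead.degree, P.row⟩ : APoly v n)).get j).Contains x := by
      intro j
      obtain ⟨E, hE, hEj⟩ := List.mem_map.1 (List.get_mem _ j)
      rw [← hEj]
      obtain ⟨d', k, hk, hE'⟩ := hinv.basis E hE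
      obtain ⟨x, hx, hxd, hxc⟩ := hE'.spec f' hf'
      exact ⟨x, prefixIdeal_mono hk hx, hE'.degree.symm ▸ hxd, hE'.degree.symm ▸ hxc⟩
    choose g hg hgc using hrep
    refine ⟨g, hgc, fun j => prefixIdeal_self (f := f') ▸ hg j, ?_⟩
    rintro p hp h0 ⟨d, hd, hpd⟩
    rw [← prefixIdeal_self] at hp
    have hdeg : (w.degree p).degree = d := degree_eq_of_isHomogeneous hpd h0
    -- The computed rows specialize into the ideals of `f'`, so the leading monomials of `f`
    -- persist; the count then excludes any new one up to degree `D`.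
    have hLM : w.degree p ∈ LM w (prefixIdeal f s) := by
      refine LM_le_of_LM_ge hf H.regular hf'h (D := D) ?_ le_rfl ⟨p, hp, h0, rfl⟩
        (hdeg.le.trans hd)
      intro k hk u hu huD
      have hT := hinv.tilde u.degree k hk (Or.inl (Nat.lt_succ_of_le huD))
      obtain ⟨E, hE, hEu⟩ := List.mem_map.1 (hT.lead u rfl hu)
      rw [← hEu]
      exact (hT.row E hE).lead_mem hf'
    have ht : Treated (D + 1) 0 d s := Or.inl (Nat.lt_succ_of_le hd)
    obtain ⟨E, hE, hEp⟩ := List.mem_map.1 ((hinv.tilde d s le_rfl ht).lead _ hdeg hLM)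
    -- Every lead found was put in the basis unless already there, so a basis element has precisely
    -- this leading monomial, not just a divisor of it.
    obtain ⟨Q, hQ, hQE⟩ := List.mem_map.1 (hinv.lead d s le_rfl ht E hE)
    obtain ⟨j, hj⟩ := List.mem_iff_get.1 (List.mem_map_of_mem
      (f := fun P => (⟨P.lead.degree, P.row⟩ : APoly v n)) hQ)
    obtain ⟨d', k, hk, hQ'⟩ := hinv.basis Q hQ
    have hc := hgc j
    rw [hj] at hc
    obtain ⟨h1, h2⟩ := hQ'.lead_eq (x := g j) (hQ'.degree ▸ hc.1) (hQ'.degree ▸ hc.2)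
    exact ⟨j, h1, by rw [h2, hQE, hEp]⟩
  · intro Q hQ
    obtain ⟨E, hE, rfl⟩ := List.mem_map.1 hQ
    obtain ⟨d', k, -, hE'⟩ := hinv.basis E hE
    refine ⟨E.lead, rfl, fun u hu => hE'.zero u (hu.trans hE'.degree), fun p hp => ?_⟩
    exact hE'.lead_eq (hE'.degree ▸ hp.1) (hE'.degree ▸ hp.2)
  · intro hD
    refine hcost'.trans ?_
    calc (D + 1) * (s * (5 * (n + D - 1).choose D ^ 3))
        ≤ (2 * D) * (s * (5 * (n + D - 1).choose D ^ 3)) := Nat.mul_le_mul_right _ (by omega)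
      _ = 10 * (s * D * (n + D - 1).choose D ^ 3) := by ring

/-! ### Reduction to `f` itself and choice of the precision bounds. -/

lemma approxPoly_congr {p q : MvPolynomial (Fin n) K} (d : ℕ)
    (h : ∀ u, ((m : ℤ) : WithTop ℤ) ≤ v (q.coeff u - p.coeff u)) :
    approxPoly v m d q = approxPoly v m d p := by
  unfold approxPoly
  congr 1
  funext u
  exact congrArg (Approx.mk _) ((contains_of_iff _ _ _).2 (h u))

/-- A lower bound for the valuations of all the coefficients. -/
lemma exists_val_bound (v : AddValuation K (WithTop ℤ)) (f : Fin s → MvPolynomial (Fin n) K) :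
    ∃ c : ℕ, ∀ i u, ((-(c : ℤ) : ℤ) : WithTop ℤ) ≤ v ((f i).coeff u) := by
  classical
  have hex : ∀ x : K, ∃ c : ℕ, ((-(c : ℤ) : ℤ) : WithTop ℤ) ≤ v x := by
    intro x
    induction v x with
    | top => exact ⟨0, le_top⟩
    | coe a => exact ⟨a.natAbs, by exact_mod_cast (by omega : -(a.natAbs : ℤ) ≤ a)⟩
  choose b hb using hex
  refine ⟨Finset.univ.sup fun i => (f i).support.sup fun u => b ((f i).coeff u), fun i u => ?_⟩
  by_cases hu : u ∈ (f i).support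
  · refine le_trans ?_ (hb _)
    have h1 := Finset.le_sup (f := fun u => b ((f i).coeff u)) hu
    have h2 := Finset.le_sup (f := fun i => (f i).support.sup fun u => b ((f i).coeff u))
      (Finset.mem_univ i)
    have h3 := h1.trans h2
    exact_mod_cast (by omega : -((Finset.univ.sup fun i =>
      (f i).support.sup fun u => b ((f i).coeff u) : ℕ) : ℤ) ≤ -(b ((f i).coeff u) : ℤ))
  · rw [notMem_support_iff.1 hu, v.map_zero]
    exact le_top

lemma exists_hasSmallMinor (v : AddValuation K (WithTop ℤ)) (w : MonomialOrder (Fin n))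
    (f : Fin s → MvPolynomial (Fin n) K) (deg : Fin s → ℕ) (c : ℤ) (D : ℕ) :
    ∃ P : ℕ, ∀ d ≤ D, ∀ i, HasSmallMinor v w f deg c P d i := by
  have hex : ∀ (d : ℕ) (i : Fin s), ∃ P : ℕ, HasSmallMinor v w f deg c P d i := by
    intro d i
    obtain ⟨e, he⟩ := exists_minor_ne_zero w f deg d i
    obtain ⟨k, hk⟩ := WithTop.ne_top_iff_exists.1 (mt v.top_iff.1 he)
    exact ⟨(k + freeColumns w f deg d i * (2 * c)).toNat, e, k, hk.symm, Int.self_le_toNat _⟩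
  choose b hb using hex
  refine ⟨(Finset.range (D + 1)).sup fun d => Finset.univ.sup (b d), fun d hd i => ?_⟩
  obtain ⟨e, k, hk, hle⟩ := hb d i
  refine ⟨e, k, hk, hle.trans ?_⟩
  have h1 := Finset.le_sup (f := b d) (Finset.mem_univ i)
  have h2 := Finset.le_sup (f := fun d => Finset.univ.sup (b d))
    (Finset.mem_range.2 (Nat.lt_succ_of_le hd))
  exact_mod_cast h1.trans h2

/-- The infimum in `minorVal` would be `0` by default on an empty set. A non-zero minor exists, and
integral coefficients make its valuation a natural number, so the infimum is attained. -/
lemma hasSmallMinor_precMF5 (hval : ∀ i u, 0 ≤ v ((f i).coeff u)) {d : ℕ} (hd : d ≤ D)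
    (i : Fin s) : HasSmallMinor v w f deg 0 (precMF5 v w f deg D) d i := by
  have hne : {k : ℕ | ∃ e : Fin (freeColumns w f deg d i) ↪ F5Row w f deg d i,
      v (Matrix.det (fun a b : Fin (freeColumns w f deg d i) =>
        f5Matrix w f deg d i (e a) b)) = ((k : ℤ) : WithTop ℤ)}.Nonempty := by
    obtain ⟨e, he⟩ := exists_minor_ne_zero w f deg d i
    obtain ⟨k, hk⟩ := WithTop.ne_top_iff_exists.1 (mt v.top_iff.1 he)
    have h0 := le_val_det (v := v) 0 (fun a b : Fin (freeColumns w f deg d i) =>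
      f5Matrix w f deg d i (e a) b) fun a b => by
        rw [neg_zero]
        exact val_coeff_rowPoly hval (e a).1 _
    rw [← hk] at h0
    have hk0 : 0 ≤ k := by
      have : -((freeColumns w f deg d i : ℤ) * 0) ≤ k := by exact_mod_cast h0
      simpa using this
    exact ⟨k.toNat, e, by rw [Int.toNat_of_nonneg hk0]; exact hk.symm⟩
  obtain ⟨e, he⟩ := Nat.sInf_mem hne
  refine ⟨e, _, he, ?_⟩
  rw [mul_zero, mul_zero, add_zero]
  exact_mod_cast Finset.le_sup (f := fun x : ℕ × Fin s => minorVal v w f deg x.1 x.2)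
    (b := (d, i)) (by simp; omega)

end Loops

end WeakMF5

theorem theorem1p1 :
    ∃ C : ℕ, ∀ (K : Type*) [Field K] (v : AddValuation K (WithTop ℤ)) (_ : WeakMF5.IsCDVF v)
      (n s : ℕ) (w : MonomialOrder (Fin n))
      (f : Fin s → MvPolynomial (Fin n) K) (deg : Fin s → ℕ)
      (_ : ∀ i, (f i).IsHomogeneous (deg i))
      (_ : RingTheory.Sequence.IsRegular (MvPolynomial (Fin n) K) (List.ofFn f))
      (_ : ∀ i : Fin s, WeakMF5.IsWeaklyIdeal w (Ideal.span (f '' Set.Iic i)))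
      (D : ℕ),
      (∃ m₀ : ℕ, ∀ m : ℕ, m₀ ≤ m → ∀ f' : Fin s → MvPolynomial (Fin n) K,
        (∀ i, (f' i).IsHomogeneous (deg i)) →
        (∀ i u, ((m : ℤ) : WithTop ℤ) ≤ v ((f' i).coeff u - (f i).coeff u)) →
        ∃ G : List (WeakMF5.APoly v n),
          (WeakMF5.weakMF5 m w D fun i => WeakMF5.approxPoly v m (deg i) (f' i)).val = some G ∧
          WeakMF5.IsApproxDGroebner w D (fun i => WeakMF5.approxPoly v m (deg i) (f' i)) G ∧
          (1 ≤ D → (WeakMF5.weakMF5 m w D fun i => WeakMF5.approxPoly v m (deg i) (f' i)).cost ≤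
            C * (s * D * (n + D - 1).choose D ^ 3))) ∧
      ((∀ i u, 0 ≤ v ((f i).coeff u)) →
        ∀ m : ℕ, WeakMF5.precMF5 v w f deg D < m → ∀ f' : Fin s → MvPolynomial (Fin n) K,
        (∀ i, (f' i).IsHomogeneous (deg i)) →
        (∀ i u, ((m : ℤ) : WithTop ℤ) ≤ v ((f' i).coeff u - (f i).coeff u)) →
        ∃ G : List (WeakMF5.APoly v n),
          (WeakMF5.weakMF5 m w D fun i => WeakMF5.approxPoly v m (deg i) (f' i)).val = some G ∧
          WeakMF5.IsApproxDGroebner w D (fun i => WeakMF5.approxPoly v m (deg i) (f' i)) G ∧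
          (∀ P ∈ G, ∀ u : WeakMF5.Mon n, u.degree = P.deg →
            ((m : ℤ) : WithTop ℤ) ≤
              (P.coeff u).ord + ((WeakMF5.precMF5 v w f deg D : ℤ) : WithTop ℤ)) ∧
          (1 ≤ D → (WeakMF5.weakMF5 m w D fun i => WeakMF5.approxPoly v m (deg i) (f' i)).cost ≤
            C * (s * D * (n + D - 1).choose D ^ 3))) := by
  -- A factor `5` for one elimination, and `2` from `D + 1 ≤ 2 * D`.
  refine ⟨10, ?_⟩
  intro K _ v _ n s w f deg hf hreg hweak D
  have hweak' : ∀ i : Fin s, WeakMF5.IsWeaklyIdeal w (WeakMF5.prefixIdeal f (i + 1)) :=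
    fun i => WeakMF5.prefixIdeal_eq_Iic (f := f) i ▸ hweak i
  refine ⟨?_, ?_⟩
  · obtain ⟨c, hc⟩ := WeakMF5.exists_val_bound v f
    obtain ⟨P, hP⟩ := WeakMF5.exists_hasSmallMinor v w f deg c D
    -- `P` depends only on `f`, `w` and `D`, through minors of `f` and the bound `c` on its
    -- denominators.
    refine ⟨P + 1, fun m hm f' _ hf' => ?_⟩
    have hcongr : (fun i => WeakMF5.approxPoly v m (deg i) (f' i)) =
        fun i => WeakMF5.approxPoly v m (deg i) (f i) :=
      funext fun i => WeakMF5.approxPoly_congr (deg i) (hf' i)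
    rw [hcongr]
    obtain ⟨G, h1, h2, -, h3⟩ := WeakMF5.weakMF5_correct (m := m) (P := P)
      ⟨hf, hreg, hweak', by positivity, by omega, hc, hP⟩
    exact ⟨G, h1, h2, h3⟩
  · intro hval m hm f' _ hf'
    have hcongr : (fun i => WeakMF5.approxPoly v m (deg i) (f' i)) =
        fun i => WeakMF5.approxPoly v m (deg i) (f i) :=
      funext fun i => WeakMF5.approxPoly_congr (deg i) (hf' i)
    rw [hcongr]
    obtain ⟨G, h1, h2, h3, h4⟩ := WeakMF5.weakMF5_correct (m := m) (c := 0)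
      (P := WeakMF5.precMF5 v w f deg D)
      ⟨hf, hreg, hweak', le_rfl, by omega, by simpa using hval,
        fun d hd i => WeakMF5.hasSmallMinor_precMF5 hval hd i⟩
    refine ⟨G, h1, h2, fun Q hQ u hu => ?_, h4⟩
    exact WeakMF5.Approx.coe_le_add (h3 Q hQ u hu) le_rfl (by omega)
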